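/- Positive cubature rules of degree $11$ and index $10$ on $\mathbb S^d$, $3\le d\le 23$. For a finite set $X\subset\mathbb S^d$ and weights $(w_x)_{x\in X}$, the rule $Q(f)=\sum_{x\in X}w_xf(x)$ is exact for $f$ if $Q(f)$ equals the mean of $f$ over the unit sphere $\mathbb S^d\subset\mathbb R^{d+1}$ for the surface measure. It has degree $n$ if it is exact for all polynomials in $d+1$ variables of degree at most $n$, but not for all those of degree at most $n+1$; it has index $n$ if it is exact for all homogeneous polynomials of degree $n$; it is positive if all $w_x>0$. It is $\mathcal B_{d+1}$-invariant if $X$ and $w$ are invariant under the group $\mathcal B_{d+1}$ of signed permutations of the coordinates of $\mathbb R^{d+1}$. It is rational if all $w_x$ are rational and every node is a vector with rational coordinates divided by the square root of a positive rational number. For integers $1\le k\le d+1$ and $1\le p\le d$ and real $a>0$, $a\neq1$, let $v_k=\tfrac1{\sqrt k}(1,\dots,1,0,\dots,0)\in\mathbb R^{d+1}$ with $k$ ones, and let $u_{a,p}=\tfrac1{\sqrt{a+p}}(\sqrt a,1,\dots,1,0,\dots,0)\in\mathbb R^{d+1}$ with $p$ ones. For $\lambda=(\lambda_1,\dots,\lambda_6)$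 with all $\lambda_j\ge0$, consider the rule $$ Q_{d,p,m,a,\lambda}(f)=\frac{\lambda_1}{2^{d+1}}\sum_{x\in v_{d+1}\mathcal B_{d+1}}f(x)+\frac{\lambda_2}{2(d+1)}\sum_{x\in v_1\mathcal B_{d+1}}f(x)+\frac{\lambda_3}{4\binom{d+1}2}\sum_{x\in v_2\mathcal B_{d+1}}f(x)+\frac{\lambda_4}{8\binom{d+1}3}\sum_{x\in v_3\mathcal B_{d+1}}f(x) $$ $$ \qquad+\frac{\lambda_5}{2^m\binom{d+1}m}\sum_{x\in v_m\mathcal B_{d+1}}f(x)+\frac{\lambda_6}{2^{p+1}(d+1)\binom dp}\sum_{x\in u_{a,p}\mathcal B_{d+1}}f(x), $$ where orbits with $\lambda_j=0$ are left out, and the weights of coinciding nodes are added. Call such a rule *good* if it is a positive $\mathcal B_{d+1}$-invariant rule of degree $11$ on $\mathbb S^d$ and if, moreover, keeping exactly one node of each antipodal pair of nodes, with doubled weight, gives a positive rule of index $10$ on $\mathbb S^d$. (i) Let $(d,p,m)$ be one of $(3,2,4)$, $(5,3,4)$, $(7,4,4)$, $(9,5,5)$, $(11,6,5)$, $(13,7,5)$,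 $(15,8,5)$, $(17,9,5)$, $(19,10,5)$, $(21,11,5)$, $(23,12,4)$, $(4,3,4)$, $(6,4,4)$, $(8,5,5)$, $(10,6,5)$, $(12,7,5)$, $(14,8,6)$, $(16,9,6)$, $(18,10,6)$, $(20,11,6)$, $(22,12,6)$; every $d$ with $3\le d\le 23$ occurs. Put $a=10\frac{p-1}{d-1}-1$. Then $a>0$, $a\ne1$, and there are $\lambda_1,\dots,\lambda_6\ge 0$ with $\sum_j\lambda_j=1$ and $$\lambda_6=(a+p)^5\,\frac{60\,d}{p\,a\,(a-1)^2(a+1)(d+9)(d+7)(d+5)(d+3)}$$ such that $Q_{d,p,m,a,\lambda}$ is good. If $d$ is odd, then $d=2p-1$. If $d=2p-1$, then $a=4$, and $\lambda$ can be chosen so that in addition all $\lambda_j$ are rational and the rule $Q_{d,p,m,a,\lambda}$ is rational. (ii) With $a=4$, the rule $Q_{d,p,m,a,\lambda}$ is good and rational in each of the cases - $(d,p,m)=(3,2,4)$, $\lambda=\left(\frac2{15},\frac1{15},\frac18,0,0,\frac{27}{40}\right)$; - $(d,p,m)=(7,4,4)$, $\lambda=\left(\frac{32}{315},\frac1{105},\frac2{45},0,\frac2{15},\frac{32}{45}\right)$;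 - $(d,p,m)=(21,11,5)$, $\lambda=\left(\frac{14641}{705432},\frac{61}{192192},0,\frac{405}{31616},\frac{625}{14144},\frac{16875}{18304}\right)$; - $(d,p,m)=(23,12,4)$, $\lambda=\left(0,\frac1{4095},0,0,\frac{506}{12285},\frac{11776}{12285}\right)$. (iii) Let $Q$ be the rule for $d=3$ in (ii), with nodes $y$ and weights $w_y$. For all $x\in\mathbb R^4$, $$22680\Big(\sum_{i=1}^4x_i^2\Big)^5=552960\sum_{y}w_y\langle x,y\rangle^{10},$$ and this is Schur's identity $$22680\Big(\sum_{i=1}^4x_i^2\Big)^5=9\sum_4(2x_i)^{10}+180\sum_{12}(x_i\pm x_j)^{10}+\sum_{48}(2x_i\pm x_j\pm x_k)^{10}+9\sum_8(x_1\pm x_2\pm x_3\pm x_4)^{10}.$$ Here the sums run, respectively, over $1\le i\le 4$; over $i<j$ and both signs; over distinct $i,j,k$ with $j<k$ and all signs; and over all choices of the three signs. -/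

import Mathlib

open scoped BigOperators

/-- A cubature rule on the unit sphere of `ℝⁿ`: finitely many nodes, each with a real weight
(the values of `weight` outside `nodes` play no role). -/
structure CubatureRule (n : ℕ) where
  nodes : Finset (EuclideanSpace ℝ (Fin n))
  weight : EuclideanSpace ℝ (Fin n) → ℝ

namespace CubatureRule

variable {n : ℕ}

/-- The value of the rule on the function `f`. -/
noncomputable def apply (Q : CubatureRule n) (f : EuclideanSpace ℝ (Fin n) → ℝ) : ℝ :=
  ∑ x ∈ Q.nodes, Q.weight x * f x

/-- The mean of `f` over the unit sphere of `ℝⁿ` for the surface measure. -/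
noncomputable def sphereMean (f : EuclideanSpace ℝ (Fin n) → ℝ) : ℝ :=
  ⨍ y : Metric.sphere (0 : EuclideanSpace ℝ (Fin n)) 1, f (y : EuclideanSpace ℝ (Fin n))
    ∂((MeasureTheory.volume : MeasureTheory.Measure (EuclideanSpace ℝ (Fin n))).toSphere)

/-- The rule reproduces the mean over the sphere of the polynomial `f`. -/
def IsExactFor (Q : CubatureRule n) (f : MvPolynomial (Fin n) ℝ) : Prop :=
  sphereMean (fun x => MvPolynomial.eval (fun i => x i) f) =
    Q.apply (fun x => MvPolynomial.eval (fun i => x i) f)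

/-- Degree `t`: exact for all polynomials of degree at most `t`, but not for all polynomials of
degree at most `t + 1`. -/
def IsOfDegree (Q : CubatureRule n) (t : ℕ) : Prop :=
  (∀ f : MvPolynomial (Fin n) ℝ, f.totalDegree ≤ t → Q.IsExactFor f) ∧
    ∃ f : MvPolynomial (Fin n) ℝ, f.totalDegree ≤ t + 1 ∧ ¬ Q.IsExactFor f

/-- Index `t`: exact for all homogeneous polynomials of degree `t`. -/
def IsOfIndex (Q : CubatureRule n) (t : ℕ) : Prop :=
  ∀ f : MvPolynomial (Fin n) ℝ, f.IsHomogeneous t → Q.IsExactFor f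

/-- All nodes are points of the unit sphere. -/
def OnSphere (Q : CubatureRule n) : Prop :=
  ∀ x ∈ Q.nodes, ‖x‖ = 1

/-- All weights are positive. -/
def IsPositive (Q : CubatureRule n) : Prop :=
  ∀ x ∈ Q.nodes, 0 < Q.weight x

/-- `Q'` keeps exactly one node of each antipodal pair `{x, -x}` of nodes of `Q`, with twice
the weight. -/
def IsHalfOf (Q' Q : CubatureRule n) : Prop :=
  Q'.nodes ⊆ Q.nodes ∧ (∀ x ∈ Q.nodes, -x ∈ Q.nodes) ∧
    (∀ x ∈ Q.nodes, (x ∈ Q'.nodes ↔ -x ∉ Q'.nodes)) ∧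
    ∀ x ∈ Q'.nodes, Q'.weight x = 2 * Q.weight x

/-- All weights are rational, and every node is a vector with rational coordinates divided by the
square root of a positive rational number. -/
def IsRational (Q : CubatureRule n) : Prop :=
  ∀ x ∈ Q.nodes, (∃ q : ℚ, Q.weight x = (q : ℝ)) ∧
    ∃ r : ℚ, 0 < r ∧ ∀ i, ∃ b : ℚ, x i = (b : ℝ) / Real.sqrt (r : ℝ)

end CubatureRule

/-- The element of the Weyl group of type `B` that permutes the coordinates by `σ` and multiplies
them by the signs `ε`. The group consists exactly of these maps. -/
noncomputable def signedPerm {n : ℕ} (σ : Equiv.Perm (Fin n)) (ε : Fin n → ℤˣ)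
    (x : EuclideanSpace ℝ (Fin n)) : EuclideanSpace ℝ (Fin n) :=
  WithLp.toLp 2 (fun i => ((ε i : ℤ) : ℝ) * x (σ i))

open Classical in
/-- The orbit of `x` under the Weyl group of type `B`. -/
noncomputable def orbitB {n : ℕ} (x : EuclideanSpace ℝ (Fin n)) :
    Finset (EuclideanSpace ℝ (Fin n)) :=
  (Finset.univ : Finset (Equiv.Perm (Fin n) × (Fin n → ℤˣ))).image
    (fun g => signedPerm g.1 g.2 x)

/-- The nodes are permuted by the Weyl group of type `B`, and the weights are constant on its
orbits. -/
def CubatureRule.IsInvariantB {n : ℕ} (Q : CubatureRule n) : Prop :=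
  ∀ (σ : Equiv.Perm (Fin n)) (ε : Fin n → ℤˣ), ∀ x ∈ Q.nodes,
    signedPerm σ ε x ∈ Q.nodes ∧ Q.weight (signedPerm σ ε x) = Q.weight x

/-- The point `(1/√k, …, 1/√k, 0, …, 0)` of `ℝⁿ`, with `k` nonzero coordinates. -/
noncomputable def nodeV (n k : ℕ) : EuclideanSpace ℝ (Fin n) :=
  WithLp.toLp 2 (fun i => if (i : ℕ) < k then 1 / Real.sqrt (k : ℝ) else 0)

/-- The point `(√(a/(a+p)), 1/√(a+p), …, 1/√(a+p), 0, …, 0)` of `ℝⁿ`, where `1/√(a+p)` stands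
`p` times. -/
noncomputable def nodeU (n p : ℕ) (a : ℝ) : EuclideanSpace ℝ (Fin n) :=
  WithLp.toLp 2 (fun i =>
    if (i : ℕ) = 0 then Real.sqrt (a / (a + p))
    else if (i : ℕ) ≤ p then 1 / Real.sqrt (a + p) else 0)

/-- The generators of the six orbits of nodes on the unit sphere of `ℝ^(d+1)`. -/
noncomputable def generator (d p m : ℕ) (a : ℝ) : Fin 6 → EuclideanSpace ℝ (Fin (d + 1)) :=
  ![nodeV (d + 1) (d + 1), nodeV (d + 1) 1, nodeV (d + 1) 2, nodeV (d + 1) 3,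
    nodeV (d + 1) m, nodeU (d + 1) p a]

/-- The sizes of the six orbits (for `a ≠ 1`). -/
def orbitSize (d p m : ℕ) : Fin 6 → ℕ :=
  ![2 ^ (d + 1), 2 * (d + 1), 4 * (d + 1).choose 2, 8 * (d + 1).choose 3,
    2 ^ m * (d + 1).choose m, 2 ^ (p + 1) * (d + 1) * d.choose p]

open Classical in
/-- The rule `f ↦ ∑ⱼ lamⱼ / Nⱼ · ∑_{x in the j-th orbit} f x` with `Nⱼ` the size of the `j`-th
orbit. Orbits with coefficient zero are left out; a node that lies in several of the orbits
receives the sum of its weights. -/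
noncomputable def sixOrbitRule (d p m : ℕ) (a : ℝ) (lam : Fin 6 → ℝ) : CubatureRule (d + 1) where
  nodes := (Finset.univ.filter (fun j => lam j ≠ 0)).biUnion
    (fun j => orbitB (generator d p m a j))
  weight x := ∑ j, if x ∈ orbitB (generator d p m a j) then lam j / (orbitSize d p m j : ℝ) else 0

/-- The rule is a positive rule of degree 11 on the sphere, invariant under the Weyl group of type
`B`, which reduces by antipodality to a positive rule of index 10 with half as many nodes. -/
def CubatureRule.IsPositiveInvariantOfDegreeEleven {n : ℕ} (Q : CubatureRule n) : Prop :=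
  Q.OnSphere ∧ Q.IsPositive ∧ Q.IsInvariantB ∧ Q.IsOfDegree 11 ∧
    ∃ Q' : CubatureRule n, Q'.IsHalfOf Q ∧ Q'.OnSphere ∧ Q'.IsPositive ∧ Q'.IsOfIndex 10

/-- The parameters `(d, p, m)`. -/
def parameters : List (ℕ × ℕ × ℕ) :=
  [(3, 2, 4), (5, 3, 4), (7, 4, 4), (9, 5, 5), (11, 6, 5), (13, 7, 5), (15, 8, 5), (17, 9, 5),
    (19, 10, 5), (21, 11, 5), (23, 12, 4),
    (4, 3, 4), (6, 4, 4), (8, 5, 5), (10, 6, 5), (12, 7, 5), (14, 8, 6), (16, 9, 6), (18, 10, 6),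
    (20, 11, 6), (22, 12, 6)]

/-- The parameter `a` of the sixth orbit. -/
noncomputable def parameterA (d p : ℕ) : ℝ :=
  10 * (((p : ℝ) - 1) / ((d : ℝ) - 1)) - 1

/-- The right-hand side of Schur's identity: a sum of 10th powers of `4 + 12 + 48 + 8` linear
forms in four variables. -/
def schurSum (x : Fin 4 → ℝ) : ℝ :=
  9 * ∑ i, (2 * x i) ^ 10
  + 180 * ∑ i, ∑ j ∈ Finset.Ioi i, ∑ ε ∈ ({1, -1} : Finset ℤ), (x i + ε * x j) ^ 10
  + ∑ i, ∑ j ∈ Finset.univ.erase i, ∑ k ∈ (Finset.Ioi j).erase i,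
      ∑ ε ∈ ({1, -1} : Finset ℤ), ∑ δ ∈ ({1, -1} : Finset ℤ),
        (2 * x i + ε * x j + δ * x k) ^ 10
  + 9 * ∑ ε ∈ ({1, -1} : Finset ℤ), ∑ δ ∈ ({1, -1} : Finset ℤ), ∑ η ∈ ({1, -1} : Finset ℤ),
      (x 0 + ε * x 1 + δ * x 2 + η * x 3) ^ 10

/-!
Both the rules and the mean over the sphere are invariant under signed permutations, and averaging a
monomial over this group gives a polynomial in the power sums `sₖ = ∑ xᵢ ^ k` with `k` even. On the
sphere `s₂ = 1`, so up to degree 11 a rule only has to be exact for `s₂ₖ` with `k ≤ 5`, `s₄ ^ 2` and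
`s₆ * s₄`. At `(1, …, 1, 0, …, 0) / √r` the value of `s₂ₖ` is `(1 / r) ^ (k - 1)`, whence
`s₂ₖ * s₄ = s₂ₖ₊₂` there: the differences `s₂ₖ * s₄ - s₂ₖ₊₂` only see the sixth orbit, and their
exactness for `k = 2, 3` determines `a` and `λ₆`. What is left is a Vandermonde system in the values
`1 / r` for the other coefficients. Degree 12 is out of reach because some polynomial of degree 12
vanishes at all the nodes while its mean is a nonzero multiple of `a ^ 2 - 6 * a + 1`, which has no
rational zero.
-/

section PolarCoordinates

open MeasureTheory Module Set

theorem integral_volumeIoiPow (m : ℕ) (g : ℝ → ℝ) :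
    ∫ r : Ioi (0 : ℝ), g r ∂(Measure.volumeIoiPow m) = ∫ r in Ioi (0 : ℝ), r ^ m * g r := by
  simp only [Measure.volumeIoiPow, ENNReal.ofReal]
  rw [integral_withDensity_eq_integral_smul (measurable_subtype_coe.pow_const _).real_toNNReal,
    integral_subtype_comap measurableSet_Ioi fun r ↦ Real.toNNReal (r ^ m) • g r]
  refine setIntegral_congr_fun measurableSet_Ioi fun r hr ↦ ?_
  rw [NNReal.smul_def, Real.coe_toNNReal _ (pow_nonneg (le_of_lt hr) _), smul_eq_mul]

variable {E : Type*} [NormedAddCommGroup E] [NormedSpace ℝ E] [FiniteDimensional ℝ E]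
  [Nontrivial E] [MeasurableSpace E] [BorelSpace E] (μ : Measure E) [μ.IsAddHaarMeasure]

theorem integral_homogeneous_mul_comp_norm {k : ℕ} {f : E → ℝ}
    (hf : ∀ r : ℝ, 0 < r → ∀ x, f (r • x) = r ^ k * f x) (g : ℝ → ℝ) :
    ∫ x, f x * g ‖x‖ ∂μ =
      (∫ y, f y ∂μ.toSphere) * ∫ r in Ioi (0 : ℝ), r ^ (finrank ℝ E - 1 + k) * g r := by
  have polar : ∀ x : ({0}ᶜ : Set E), f x * g ‖(x : E)‖ =
      f (homeomorphUnitSphereProd E x).1 *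
        ((homeomorphUnitSphereProd E x).2 ^ k * g (homeomorphUnitSphereProd E x).2) := by
    intro x
    have hx : 0 < ‖(x : E)‖ := norm_pos_iff.2 x.2
    rw [homeomorphUnitSphereProd_apply_snd_coe, homeomorphUnitSphereProd_apply_fst_coe,
      hf _ (inv_pos.2 hx), inv_pow]
    field_simp
  calc ∫ x, f x * g ‖x‖ ∂μ
      = ∫ x : ({0}ᶜ : Set E), f x * g ‖(x : E)‖ ∂(μ.comap (↑)) := by
        rw [integral_subtype_comap (measurableSet_singleton _).compl fun x ↦ f x * g ‖x‖,
          restrict_compl_singleton]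
    _ = ∫ z, f z.1 * ((z.2 : ℝ) ^ k * g z.2)
          ∂μ.toSphere.prod (.volumeIoiPow (finrank ℝ E - 1)) := by
        simp only [polar]
        exact μ.measurePreserving_homeomorphUnitSphereProd.integral_comp
          (Homeomorph.measurableEmbedding _) fun z ↦ f z.1 * ((z.2 : ℝ) ^ k * g z.2)
    _ = _ := by
        rw [integral_prod_mul (fun y : Metric.sphere (0 : E) 1 ↦ f y)
          (fun r : Ioi (0 : ℝ) ↦ (r : ℝ) ^ k * g r),
          integral_volumeIoiPow _ fun r ↦ r ^ k * g r]
        simp only [pow_add, mul_assoc]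

theorem integral_Ioi_pow_mul_exp_neg_sq (k : ℕ) :
    ∫ r in Ioi (0 : ℝ), r ^ k * Real.exp (-r ^ 2) = Real.Gamma ((k + 1 : ℝ) / 2) / 2 := by
  have h := integral_rpow_mul_exp_neg_rpow (p := 2) (q := k) (by norm_num)
    (by linarith [Nat.cast_nonneg (α := ℝ) k])
  simp only [Real.rpow_natCast, Real.rpow_ofNat] at h
  rw [h]
  ring

theorem integral_homogeneous_mul_exp_neg_norm_sq {k : ℕ} {f : E → ℝ}
    (hf : ∀ r : ℝ, 0 < r → ∀ x, f (r • x) = r ^ k * f x) :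
    ∫ x, f x * Real.exp (-‖x‖ ^ 2) ∂μ =
      (∫ y, f y ∂μ.toSphere) * (Real.Gamma ((finrank ℝ E + k : ℝ) / 2) / 2) := by
  have hdim : ((finrank ℝ E - 1 + k : ℕ) : ℝ) + 1 = finrank ℝ E + k := by
    rw [Nat.cast_add, Nat.cast_pred finrank_pos]
    ring
  rw [integral_homogeneous_mul_comp_norm μ hf fun r ↦ Real.exp (-r ^ 2),
    integral_Ioi_pow_mul_exp_neg_sq, hdim]

end PolarCoordinates

section GaussianMoments

open scoped Nat

theorem integral_pow_two_mul_mul_exp_neg_sq (k : ℕ) :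
    ∫ t : ℝ, t ^ (2 * k) * Real.exp (-t ^ 2) = (2 * k - 1)‼ * √Real.pi / 2 ^ k := by
  have habs : ∀ t : ℝ, |t| ^ (2 * k) * Real.exp (-|t| ^ 2) = t ^ (2 * k) * Real.exp (-t ^ 2) :=
    fun t ↦ by rw [pow_mul, sq_abs, ← pow_mul]
  have harg : (((2 * k : ℕ) : ℝ) + 1) / 2 = k + 1 / 2 := by
    push_cast
    ring
  have h := integral_comp_abs (f := fun t : ℝ ↦ t ^ (2 * k) * Real.exp (-t ^ 2))
  simp only [habs] at h
  rw [h, integral_Ioi_pow_mul_exp_neg_sq, harg, Real.Gamma_nat_add_half]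
  ring

theorem integral_prod_pow_mul_exp_neg_norm_sq {ι : Type*} [Fintype ι] (α : ι → ℕ) :
    ∫ x : EuclideanSpace ℝ ι, (∏ i, x i ^ α i) * Real.exp (-‖x‖ ^ 2) =
      ∏ i, ∫ t : ℝ, t ^ α i * Real.exp (-t ^ 2) := by
  rw [← MeasureTheory.integral_fintype_prod_volume_eq_prod
      fun i (t : ℝ) ↦ t ^ α i * Real.exp (-t ^ 2),
    ← (PiLp.volume_preserving_toLp ι).integral_comp
      (MeasurableEquiv.toLp 2 (ι → ℝ)).measurableEmbedding]
  simp only [EuclideanSpace.norm_sq_eq, Real.norm_eq_abs, sq_abs, Finset.prod_mul_distrib,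
    ← Real.exp_sum, Finset.sum_neg_distrib]

theorem Gamma_add_natCast {x : ℝ} (hx : 0 < x) (k : ℕ) :
    Real.Gamma (x + k) = (∏ j ∈ Finset.range k, (x + j)) * Real.Gamma x := by
  induction k with
  | zero => simp
  | succ k ih =>
    rw [Finset.prod_range_succ, Nat.cast_succ, ← add_assoc, Real.Gamma_add_one (by positivity), ih]
    ring

end GaussianMoments

namespace CubatureRule

section SphereMean

open MeasureTheory
open scoped Nat

variable {n : ℕ}

theorem sphereMean_congr {f g : EuclideanSpace ℝ (Fin n) → ℝ} (h : ∀ x, ‖x‖ = 1 → f x = g x) :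
    sphereMean f = sphereMean g :=
  integral_congr_ae (.of_forall fun y ↦ h y (by simp))

theorem sphereMean_const_mul (c : ℝ) (f : EuclideanSpace ℝ (Fin n) → ℝ) :
    sphereMean (fun x ↦ c * f x) = c * sphereMean f :=
  integral_const_mul c _

theorem sphereMean_add {f g : EuclideanSpace ℝ (Fin n) → ℝ} (hf : Continuous f)
    (hg : Continuous g) : sphereMean (fun x ↦ f x + g x) = sphereMean f + sphereMean g := by
  have integrable : ∀ {h : EuclideanSpace ℝ (Fin n) → ℝ}, Continuous h →
      Integrable (fun y : Metric.sphere (0 : EuclideanSpace ℝ (Fin n)) 1 ↦ h y)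
        ((volume.toSphere .univ)⁻¹ • volume.toSphere) := fun hh ↦
    ((hh.comp continuous_subtype_val).integrable_of_hasCompactSupport
      (.of_compactSpace _)).to_average
  exact integral_add (integrable hf) (integrable hg)

variable [NeZero n]

theorem sphereMean_eq_integral_mul_exp_neg_norm_sq {k : ℕ} {f : EuclideanSpace ℝ (Fin n) → ℝ}
    (hf : ∀ r : ℝ, 0 < r → ∀ x, f (r • x) = r ^ k * f x) :
    sphereMean f = Real.Gamma (n / 2) / Real.Gamma ((n + k : ℝ) / 2) *
      ((∫ x : EuclideanSpace ℝ (Fin n), f x * Real.exp (-‖x‖ ^ 2)) / √Real.pi ^ n) := by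
  have hn : (0 : ℝ) < n := Nat.cast_pos.2 (NeZero.pos n)
  have hΓk : Real.Gamma ((n + k : ℝ) / 2) ≠ 0 := (Real.Gamma_pos_of_pos (by positivity)).ne'
  have hΓ : Real.Gamma ((n : ℝ) / 2) ≠ 0 := (Real.Gamma_pos_of_pos (by positivity)).ne'
  have hmass : √Real.pi ^ n = (volume.toSphere (E := EuclideanSpace ℝ (Fin n))).real .univ *
      (Real.Gamma (n / 2) / 2) := by
    have hconst := integral_homogeneous_mul_exp_neg_norm_sq
      (volume : Measure (EuclideanSpace ℝ (Fin n))) (k := 0) (f := fun _ ↦ 1) (by simp)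
    have hgauss := integral_prod_pow_mul_exp_neg_norm_sq fun _ : Fin n ↦ 0
    have hline := integral_pow_two_mul_mul_exp_neg_sq 0
    simp only [mul_zero, pow_zero, Finset.prod_const_one, one_mul] at hgauss hline
    simpa [hgauss, hline] using hconst
  have hpi : √Real.pi ^ n ≠ 0 := by positivity
  have hmass_ne := left_ne_zero_of_mul (hmass ▸ hpi)
  rw [sphereMean, average_eq, integral_homogeneous_mul_exp_neg_norm_sq _ hf, hmass,
    finrank_euclideanSpace_fin, smul_eq_mul]
  field_simp

theorem sphereMean_prod_pow_two_mul (β : Fin n → ℕ) :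
    sphereMean (fun x ↦ ∏ i, x i ^ (2 * β i)) =
      (∏ i, ((2 * β i - 1)‼ : ℝ)) / ∏ j ∈ Finset.range (∑ i, β i), ((n : ℝ) + 2 * j) := by
  have hhom : ∀ r : ℝ, 0 < r → ∀ x : EuclideanSpace ℝ (Fin n),
      ∏ i, (r • x) i ^ (2 * β i) = r ^ (2 * ∑ i, β i) * ∏ i, x i ^ (2 * β i) := fun r _ x ↦ by
    simp only [PiLp.smul_apply, smul_eq_mul, mul_pow, Finset.prod_mul_distrib,
      Finset.prod_pow_eq_pow_sum, Finset.mul_sum]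
  have hn : (0 : ℝ) < n := Nat.cast_pos.2 (NeZero.pos n)
  have hΓ : Real.Gamma ((n : ℝ) / 2) ≠ 0 := (Real.Gamma_pos_of_pos (by positivity)).ne'
  have hhalf : ((n : ℝ) + (2 * ∑ i, β i : ℕ)) / 2 = n / 2 + (∑ i, β i : ℕ) := by
    push_cast
    ring
  have hprod : ∏ j ∈ Finset.range (∑ i, β i), ((n : ℝ) + 2 * j) =
      2 ^ (∑ i, β i) * ∏ j ∈ Finset.range (∑ i, β i), ((n : ℝ) / 2 + j) := by
    rw [← Finset.card_range (∑ i, β i), ← Finset.prod_const, Finset.card_range,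
      ← Finset.prod_mul_distrib]
    exact Finset.prod_congr rfl fun j _ ↦ by ring
  have hne : ∏ j ∈ Finset.range (∑ i, β i), ((n : ℝ) / 2 + j) ≠ 0 :=
    Finset.prod_ne_zero_iff.2 fun j _ ↦ by positivity
  rw [sphereMean_eq_integral_mul_exp_neg_norm_sq hhom, integral_prod_pow_mul_exp_neg_norm_sq,
    hhalf, Gamma_add_natCast (by positivity), hprod]
  simp only [integral_pow_two_mul_mul_exp_neg_sq, Finset.prod_div_distrib,
    Finset.prod_mul_distrib, Finset.prod_const, Finset.card_univ, Fintype.card_fin,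
    Finset.prod_pow_eq_pow_sum]
  field_simp [hne]

theorem sphereMean_comp_linearIsometryEquiv (f : EuclideanSpace ℝ (Fin n) → ℝ)
    (e : EuclideanSpace ℝ (Fin n) ≃ₗᵢ[ℝ] EuclideanSpace ℝ (Fin n)) :
    sphereMean (fun x ↦ f (e x)) = sphereMean f := by
  let f₀ : EuclideanSpace ℝ (Fin n) → ℝ := fun x ↦ f (‖x‖⁻¹ • x)
  have hhom : ∀ r : ℝ, 0 < r → ∀ x, f₀ (r • x) = r ^ 0 * f₀ x := fun r hr x ↦ by
    simp only [f₀, norm_smul, Real.norm_of_nonneg hr.le, smul_smul, pow_zero, one_mul]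
    congr 2
    field_simp
  have hsphere : ∀ {x}, ‖x‖ = 1 → f x = f₀ x := fun hx ↦ by simp [f₀, hx]
  rw [sphereMean_congr fun x hx ↦ hsphere ((e.norm_map x).trans hx),
    sphereMean_congr fun x hx ↦ hsphere hx, sphereMean_eq_integral_mul_exp_neg_norm_sq hhom,
    sphereMean_eq_integral_mul_exp_neg_norm_sq (f := fun x ↦ f₀ (e x))
      fun r hr x ↦ by rw [map_smul, hhom r hr]]
  congr 2
  simpa only [e.norm_map] using e.measurePreserving.integral_comp
    e.toHomeomorph.measurableEmbedding fun x ↦ f₀ x * Real.exp (-‖x‖ ^ 2)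

end SphereMean

end CubatureRule

section SignedPermutations

variable {n : ℕ}

theorem signedPerm_apply (σ : Equiv.Perm (Fin n)) (ε : Fin n → ℤˣ)
    (x : EuclideanSpace ℝ (Fin n)) (i : Fin n) :
    signedPerm σ ε x i = ((ε i : ℤ) : ℝ) * x (σ i) := rfl

theorem abs_signedPerm_apply (σ : Equiv.Perm (Fin n)) (ε : Fin n → ℤˣ)
    (x : EuclideanSpace ℝ (Fin n)) (i : Fin n) : |signedPerm σ ε x i| = |x (σ i)| := by
  rw [signedPerm_apply, abs_mul, ← Int.cast_abs, Int.abs_eq_natAbs, Int.units_natAbs, Nat.cast_one,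
    Int.cast_one, one_mul]

theorem norm_signedPerm (σ : Equiv.Perm (Fin n)) (ε : Fin n → ℤˣ)
    (x : EuclideanSpace ℝ (Fin n)) : ‖signedPerm σ ε x‖ = ‖x‖ := by
  simp only [EuclideanSpace.norm_eq, Real.norm_eq_abs, abs_signedPerm_apply]
  rw [Equiv.sum_comp σ fun i ↦ |x i| ^ 2]

theorem signedPerm_one_neg_one (x : EuclideanSpace ℝ (Fin n)) :
    signedPerm 1 (fun _ ↦ -1) x = -x := by
  ext i
  simp [signedPerm_apply]

/-- A signed permutation of the coordinates as a linear isometry. -/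
noncomputable def signedPermIsometry (σ : Equiv.Perm (Fin n)) (ε : Fin n → ℤˣ) :
    EuclideanSpace ℝ (Fin n) ≃ₗᵢ[ℝ] EuclideanSpace ℝ (Fin n) :=
  LinearIsometry.toLinearIsometryEquiv
    { toFun := signedPerm σ ε
      map_add' := fun x y ↦ by ext i; simp [signedPerm_apply, mul_add]
      map_smul' := fun c x ↦ by ext i; simp [signedPerm_apply, mul_left_comm]
      norm_map' := norm_signedPerm σ ε } rfl

theorem coe_signedPermIsometry (σ : Equiv.Perm (Fin n)) (ε : Fin n → ℤˣ) :
    ⇑(signedPermIsometry σ ε) = signedPerm σ ε := rfl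

theorem signedPerm_injective (σ : Equiv.Perm (Fin n)) (ε : Fin n → ℤˣ) :
    Function.Injective (signedPerm σ ε) :=
  coe_signedPermIsometry σ ε ▸ (signedPermIsometry σ ε).injective

end SignedPermutations

section PowerSums

open MvPolynomial

theorem exists_perm_eqOn_of_injOn {α : Type*} [Finite α] {s : Finset α} {f : α → α}
    (hf : Set.InjOn f s) : ∃ σ : Equiv.Perm α, Set.EqOn σ f s := by
  classical
  have := Fintype.ofFinite α
  obtain ⟨σ, hσ⟩ := Finset.exists_equiv_extend_of_card_eq Finset.card_univ.symm
    (Finset.subset_univ _) hf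
  exact ⟨σ.trans (Equiv.subtypeUnivEquiv Finset.mem_univ), hσ⟩

theorem card_support_sum_fiber_lt {ι κ : Type*} [Fintype ι] [Fintype κ] [DecidableEq κ]
    {g : ι → κ} {m : ι → ℕ} (hg : ¬Set.InjOn g {i | m i ≠ 0}) :
    (Finset.univ.filter fun j ↦ ∑ i with g i = j, m i ≠ 0).card <
      (Finset.univ.filter fun i ↦ m i ≠ 0).card := by
  have hsubset : (Finset.univ.filter fun j ↦ ∑ i with g i = j, m i ≠ 0) ⊆
      (Finset.univ.filter fun i ↦ m i ≠ 0).image g := by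
    intro j hj
    obtain ⟨i, hi, hmi⟩ := Finset.exists_ne_zero_of_sum_ne_zero (Finset.mem_filter.1 hj).2
    exact Finset.mem_image.2 ⟨i, by simpa using hmi, (Finset.mem_filter.1 hi).2⟩
  refine (Finset.card_le_card hsubset).trans_lt (Finset.card_image_le.lt_of_ne ?_)
  rw [Ne, Finset.card_image_iff]
  simpa using hg

variable {ι σ R : Type*} [Fintype ι] [Fintype σ] [CommSemiring R]

theorem prod_psum_eq_sum [DecidableEq ι] (m : ι → ℕ) :
    ∏ i, psum σ R (m i) = ∑ g : ι → σ, ∏ i, X (g i) ^ m i := by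
  simp only [psum, Finset.prod_univ_sum, Fintype.piFinset_univ]

theorem prod_X_comp_pow [DecidableEq σ] (g : ι → σ) (m : ι → ℕ) :
    ∏ i, (X (g i) : MvPolynomial σ R) ^ m i = ∏ j, X j ^ ∑ i with g i = j, m i := by
  rw [← Finset.prod_fiberwise _ g]
  refine Finset.prod_congr rfl fun j _ ↦ ?_
  rw [← Finset.prod_pow_eq_pow_sum]
  exact Finset.prod_congr rfl fun i hi ↦ by rw [(Finset.mem_filter.1 hi).2]

theorem eval_psum_two_of_norm_eq_one {n : ℕ} {x : EuclideanSpace ℝ (Fin n)} (hx : ‖x‖ = 1) :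
    eval (fun i ↦ x i) (psum (Fin n) ℝ 2) = 1 := by
  have h := EuclideanSpace.norm_sq_eq x
  simp only [Real.norm_eq_abs, sq_abs, hx, one_pow] at h
  simp [psum, ← h]

end PowerSums

namespace CubatureRule

section ErrorFunctional

open MvPolynomial

variable {n : ℕ}

/-- The mean over the sphere, as a linear functional on polynomials. -/
noncomputable def polynomialMean (n : ℕ) : MvPolynomial (Fin n) ℝ →ₗ[ℝ] ℝ where
  toFun f := sphereMean fun x ↦ eval (fun i ↦ x i) f
  map_add' f g := by
    have hcont : ∀ f : MvPolynomial (Fin n) ℝ,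
        Continuous fun x : EuclideanSpace ℝ (Fin n) ↦ eval (fun i ↦ x i) f :=
      fun f ↦ (MvPolynomial.continuous_eval f).comp (by fun_prop)
    simp only [eval_add, sphereMean_add (hcont f) (hcont g)]
  map_smul' c f := by
    simp only [smul_eval, sphereMean_const_mul, smul_eq_mul, RingHom.id_apply]

/-- The mean over the sphere minus the value of the rule, as a linear functional on polynomials. -/
noncomputable def error (Q : CubatureRule n) : MvPolynomial (Fin n) ℝ →ₗ[ℝ] ℝ :=
  polynomialMean n - ∑ x ∈ Q.nodes, Q.weight x • (aeval fun i ↦ x i).toLinearMap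

theorem error_apply (Q : CubatureRule n) (f : MvPolynomial (Fin n) ℝ) :
    Q.error f = polynomialMean n f - Q.apply fun x ↦ eval (fun i ↦ x i) f := by
  simp [error, apply, aeval_eq_eval]

theorem isExactFor_iff_error_eq_zero {Q : CubatureRule n} {f : MvPolynomial (Fin n) ℝ} :
    Q.IsExactFor f ↔ Q.error f = 0 := by
  rw [error_apply, sub_eq_zero]
  rfl

theorem OnSphere.error_congr {Q : CubatureRule n} (hQ : Q.OnSphere)
    {f g : MvPolynomial (Fin n) ℝ}
    (h : ∀ x : EuclideanSpace ℝ (Fin n), ‖x‖ = 1 →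
      eval (fun i ↦ x i) f = eval (fun i ↦ x i) g) : Q.error f = Q.error g := by
  rw [error_apply, error_apply]
  exact congrArg₂ (· - ·) (sphereMean_congr h)
    (Finset.sum_congr rfl fun x hx ↦ congrArg (Q.weight x * ·) (h x (hQ x hx)))

theorem IsInvariantB.apply_comp_signedPerm {Q : CubatureRule n} (hQ : Q.IsInvariantB)
    (σ : Equiv.Perm (Fin n)) (ε : Fin n → ℤˣ) (f : EuclideanSpace ℝ (Fin n) → ℝ) :
    Q.apply (fun x ↦ f (signedPerm σ ε x)) = Q.apply f := by
  have hmaps : Set.MapsTo (signedPerm σ ε) Q.nodes Q.nodes := fun x hx ↦ (hQ σ ε x hx).1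
  have hinj := (signedPerm_injective σ ε).injOn (s := Q.nodes)
  exact Finset.sum_nbij (signedPerm σ ε) hmaps hinj
    (Finset.surjOn_of_injOn_of_card_le _ hmaps hinj le_rfl)
    fun x hx ↦ by rw [(hQ σ ε x hx).2]

variable [NeZero n]

theorem IsInvariantB.error_eq_of_comp_signedPerm {Q : CubatureRule n} (hQ : Q.IsInvariantB)
    (σ : Equiv.Perm (Fin n)) (ε : Fin n → ℤˣ) {f g : MvPolynomial (Fin n) ℝ}
    (h : ∀ x : EuclideanSpace ℝ (Fin n),
      eval (fun i ↦ x i) f = eval (fun i ↦ signedPerm σ ε x i) g) : Q.error f = Q.error g := by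
  simp only [error_apply, polynomialMean, LinearMap.coe_mk, AddHom.coe_mk, h]
  exact congrArg₂ (· - ·) (sphereMean_comp_linearIsometryEquiv
    (fun x ↦ eval (fun i ↦ x i) g) (signedPermIsometry σ ε))
    (hQ.apply_comp_signedPerm σ ε fun x ↦ eval (fun i ↦ x i) g)

theorem IsInvariantB.error_rename {Q : CubatureRule n} (hQ : Q.IsInvariantB)
    (σ : Equiv.Perm (Fin n)) (f : MvPolynomial (Fin n) ℝ) :
    Q.error (rename σ f) = Q.error f :=
  hQ.error_eq_of_comp_signedPerm σ 1 fun x ↦ by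
    rw [eval_rename]
    congr 2
    ext i
    simp [signedPerm_apply]

theorem IsInvariantB.error_prod_X_pow_of_odd {Q : CubatureRule n} (hQ : Q.IsInvariantB)
    {α : Fin n → ℕ} {i : Fin n} (hi : Odd (α i)) : Q.error (∏ j, X j ^ α j) = 0 := by
  have hneg : Q.error (-∏ j, X j ^ α j) = Q.error (∏ j, X j ^ α j) :=
    hQ.error_eq_of_comp_signedPerm 1 (Function.update 1 i (-1)) fun x ↦ by
      have hfactor : ∀ j, signedPerm 1 (Function.update 1 i (-1)) x j ^ α j =
          (if j = i then -1 else 1) * x j ^ α j := by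
        intro j
        rcases eq_or_ne j i with rfl | hj
        · simp [signedPerm_apply, hi.neg_pow]
        · simp [signedPerm_apply, hj]
      simp only [map_neg, eval_prod, map_pow, eval_X, hfactor, Finset.prod_mul_distrib,
        Finset.prod_ite_eq', Finset.mem_univ, if_true, neg_one_mul]
  rw [map_neg] at hneg
  linarith

theorem IsInvariantB.error_prod_X_comp_pow_of_injOn {Q : CubatureRule n} (hQ : Q.IsInvariantB)
    {m : Fin n → ℕ} {g : Fin n → Fin n} (hg : Set.InjOn g {i | m i ≠ 0}) :
    Q.error (∏ i, X (g i) ^ m i) = Q.error (∏ i, X i ^ m i) := by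
  classical
  obtain ⟨σ, hσ⟩ := exists_perm_eqOn_of_injOn (s := {i | m i ≠ 0}) (by simpa using hg)
  have hrename : rename σ (∏ i, X i ^ m i : MvPolynomial (Fin n) ℝ) = ∏ i, X (g i) ^ m i := by
    rw [map_prod]
    refine Finset.prod_congr rfl fun i _ ↦ ?_
    rcases eq_or_ne (m i) 0 with hi | hi
    · simp [hi]
    · rw [map_pow, rename_X, hσ (by simpa using hi)]
  rw [← hrename, hQ.error_rename]

/-- Expanding `∏ i, psum (2 * β i)` over all maps `g : Fin n → Fin n`, the maps that are injective
on the support of `β` give permuted copies of the monomial with exponents `2 * β`, and all others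
give monomials in fewer variables. -/
theorem IsInvariantB.error_prod_X_pow_two_mul_eq_zero {Q : CubatureRule n} (hQ : Q.IsInvariantB)
    {t : ℕ} (h : ∀ β : Fin n → ℕ, ∑ i, β i ≤ t → Q.error (∏ i, psum (Fin n) ℝ (2 * β i)) = 0)
    (β : Fin n → ℕ) (hβ : ∑ i, β i ≤ t) : Q.error (∏ i, X i ^ (2 * β i)) = 0 := by
  classical
  induction hs : (Finset.univ.filter fun i ↦ β i ≠ 0).card using Nat.strong_induction_on
    generalizing β with
  | _ s ih =>
    have of_injOn : ∀ g : Fin n → Fin n, Set.InjOn g {i | β i ≠ 0} →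
        Q.error (∏ i, X (g i) ^ (2 * β i)) = Q.error (∏ i, X i ^ (2 * β i)) :=
      fun g hg ↦ hQ.error_prod_X_comp_pow_of_injOn (by simpa using hg)
    have of_not_injOn : ∀ g : Fin n → Fin n, ¬Set.InjOn g {i | β i ≠ 0} →
        Q.error (∏ i, X (g i) ^ (2 * β i)) = 0 := by
      intro g hg
      rw [prod_X_comp_pow]
      simp only [← Finset.mul_sum]
      exact ih _ ((card_support_sum_fiber_lt hg).trans_eq hs) _
        ((Finset.sum_fiberwise _ g β).trans_le hβ) rfl
    have hcount : (Finset.univ.filter fun g : Fin n → Fin n ↦ Set.InjOn g {i | β i ≠ 0}).card •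
        Q.error (∏ i, X i ^ (2 * β i)) = 0 := by
      rw [← h β hβ, prod_psum_eq_sum, map_sum, ← Finset.sum_const, Finset.sum_filter]
      exact Finset.sum_congr rfl fun g _ ↦ by
        split_ifs with hg
        exacts [(of_injOn g hg).symm, (of_not_injOn g hg).symm]
    exact (smul_eq_zero.1 hcount).resolve_left
      (Finset.card_pos.2 ⟨id, by simp [Function.injective_id.injOn]⟩).ne'

theorem IsInvariantB.isExactFor_of_error_prod_psum {Q : CubatureRule n} (hQ : Q.IsInvariantB)
    {t : ℕ} (h : ∀ β : Fin n → ℕ, ∑ i, β i ≤ t → Q.error (∏ i, psum (Fin n) ℝ (2 * β i)) = 0)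
    {f : MvPolynomial (Fin n) ℝ} (hf : f.totalDegree ≤ 2 * t + 1) : Q.IsExactFor f := by
  rw [isExactFor_iff_error_eq_zero, f.as_sum, map_sum]
  refine Finset.sum_eq_zero fun α hα ↦ ?_
  have hmonomial : monomial α (coeff α f) = coeff α f • ∏ i, X i ^ α i := by
    rw [monomial_eq, Finsupp.prod_fintype _ _ (by simp), C_mul']
  rw [hmonomial, map_smul]
  refine smul_eq_zero_of_right _ ?_
  by_cases hodd : ∃ i, Odd (α i)
  · obtain ⟨i, hi⟩ := hodd
    exact hQ.error_prod_X_pow_of_odd hi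
  · push Not at hodd
    choose β hβ using fun i ↦ (Nat.not_odd_iff_even.1 (hodd i)).exists_two_nsmul
    simp only [smul_eq_mul] at hβ
    have hdeg : ∑ i, α i ≤ 2 * t + 1 := by
      simpa [Finsupp.sum_fintype] using (le_totalDegree hα).trans hf
    simp only [hβ, ← Finset.mul_sum] at hdeg ⊢
    exact hQ.error_prod_X_pow_two_mul_eq_zero h β (by omega)

theorem IsInvariantB.isExactFor_of_error_prod_map_psum {Q : CubatureRule n}
    (hQ : Q.IsInvariantB) (hS : Q.OnSphere) {t : ℕ}
    (h : ∀ s : Multiset ℕ, (∀ k ∈ s, 2 ≤ k) → s.sum ≤ t →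
      Q.error (s.map fun k ↦ psum (Fin n) ℝ (2 * k)).prod = 0)
    {f : MvPolynomial (Fin n) ℝ} (hf : f.totalDegree ≤ 2 * t + 1) : Q.IsExactFor f := by
  refine hQ.isExactFor_of_error_prod_psum (fun β hβ ↦ ?_) hf
  set large := Finset.univ.filter fun i ↦ 2 ≤ β i
  have hsphere : Q.error (∏ i, psum (Fin n) ℝ (2 * β i)) =
      Q.error ((∏ i with ¬ 2 ≤ β i, if β i = 0 then (n : ℝ) else 1) •
        ∏ i ∈ large, psum (Fin n) ℝ (2 * β i)) := by
    refine hS.error_congr fun x hx ↦ ?_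
    rw [← Finset.prod_filter_mul_prod_filter_not _ (fun i ↦ 2 ≤ β i), mul_comm, eval_mul,
      smul_eval, eval_prod]
    congr 1
    refine Finset.prod_congr rfl fun i hi ↦ ?_
    have hi := (Finset.mem_filter.1 hi).2
    split_ifs with h0
    · simp [h0, psum]
    · rw [show 2 * β i = 2 by omega, eval_psum_two_of_norm_eq_one hx]
  have hlarge := h (large.val.map β) (by simp [large])
    ((Finset.sum_le_univ_sum_of_nonneg fun _ ↦ Nat.zero_le _).trans hβ)
  rw [Multiset.map_map] at hlarge
  rw [hsphere, map_smul]
  exact smul_eq_zero_of_right _ hlarge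

theorem IsInvariantB.isExactFor_of_totalDegree_le_eleven {Q : CubatureRule n}
    (hQ : Q.IsInvariantB) (hS : Q.OnSphere) (hone : Q.error 1 = 0)
    (hsingle : ∀ k, 2 ≤ k → k ≤ 5 → Q.error (psum (Fin n) ℝ (2 * k)) = 0)
    (hpair : ∀ k, 2 ≤ k → k ≤ 3 → Q.error (psum (Fin n) ℝ (2 * k) * psum (Fin n) ℝ 4) = 0)
    {f : MvPolynomial (Fin n) ℝ} (hf : f.totalDegree ≤ 11) : Q.IsExactFor f := by
  refine hQ.isExactFor_of_error_prod_map_psum hS (t := 5) (fun s hs hsum ↦ ?_) hf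
  have hcard : s.card ≤ 2 := by
    have := Multiset.card_nsmul_le_sum hs
    rw [smul_eq_mul] at this
    omega
  interval_cases hc : s.card
  · rw [Multiset.card_eq_zero.1 hc]
    simpa using hone
  · obtain ⟨k, rfl⟩ := Multiset.card_eq_one.1 hc
    simp only [Multiset.mem_singleton, forall_eq, Multiset.sum_singleton] at hs hsum
    simpa using hsingle k hs hsum
  · obtain ⟨k, l, rfl⟩ := Multiset.card_eq_two.1 hc
    have hk := hs k (by simp)
    have hl := hs l (by simp)
    have hkl : k + l ≤ 5 := by simpa using hsum
    rcases hl.eq_or_lt with rfl | hl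
    · simpa using hpair k hk (by omega)
    · obtain rfl : k = 2 := by omega
      simpa [mul_comm] using hpair l hl.le (by omega)

end ErrorFunctional

section HalfRules

variable {n : ℕ}

theorem IsHalfOf.apply_eq {Q Q' : CubatureRule n} (h : Q'.IsHalfOf Q)
    (hweight : ∀ x ∈ Q.nodes, Q.weight (-x) = Q.weight x)
    {f : EuclideanSpace ℝ (Fin n) → ℝ} (hf : f.Even) : Q'.apply f = Q.apply f := by
  classical
  obtain ⟨hsubset, hneg, hone, hdouble⟩ := h
  have hremoved : ∑ x ∈ Q.nodes \ Q'.nodes, Q.weight x * f x =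
      ∑ x ∈ Q'.nodes, Q.weight x * f x := by
    refine Finset.sum_nbij' Neg.neg Neg.neg (fun x hx ↦ ?_) (fun x hx ↦ ?_)
      (fun x _ ↦ neg_neg x) (fun x _ ↦ neg_neg x) fun x hx ↦ ?_
    · obtain ⟨hx, hx'⟩ := Finset.mem_sdiff.1 hx
      exact of_not_not (mt (hone x hx).2 hx')
    · have hxQ := hsubset hx
      exact Finset.mem_sdiff.2 ⟨hneg x hxQ, (hone x hxQ).1 hx⟩
    · rw [hweight x (Finset.mem_sdiff.1 hx).1, hf]
  rw [apply, apply, ← Finset.sum_sdiff hsubset, hremoved, ← Finset.sum_add_distrib]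
  exact Finset.sum_congr rfl fun x hx ↦ by
    rw [hdouble x hx]
    ring

theorem exists_isHalfOf {Q : CubatureRule n} (hzero : 0 ∉ Q.nodes)
    (hneg : ∀ x ∈ Q.nodes, -x ∈ Q.nodes) : ∃ Q' : CubatureRule n, Q'.IsHalfOf Q := by
  classical
  refine ⟨⟨Q.nodes.filter fun x ↦ 0 < toLex x.ofLp, fun x ↦ 2 * Q.weight x⟩,
    Finset.filter_subset _ _, hneg, fun x hx ↦ ?_, fun x _ ↦ rfl⟩
  have hx0 : toLex x.ofLp ≠ 0 := fun h ↦ hzero ((PiLp.ext fun i ↦ congrFun h i : x = 0) ▸ hx)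
  simp only [Finset.mem_filter, hx, hneg x hx, true_and, WithLp.ofLp_neg, toLex_neg,
    Left.neg_pos_iff]
  exact ⟨lt_asymm, fun h ↦ (not_lt.1 h).lt_of_ne hx0.symm⟩

theorem even_eval_of_isHomogeneous {f : MvPolynomial (Fin n) ℝ} {k : ℕ} (hf : f.IsHomogeneous k)
    (hk : Even k) :
    (fun x : EuclideanSpace ℝ (Fin n) ↦ MvPolynomial.eval (fun i ↦ x i) f).Even := by
  intro x
  simp only [MvPolynomial.eval_eq', PiLp.neg_apply, ← neg_one_mul (x _), mul_pow,
    Finset.prod_mul_distrib, Finset.prod_pow_eq_pow_sum]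
  refine Finset.sum_congr rfl fun α hα ↦ ?_
  have hdeg : ∑ i, α i = k := by
    rw [← Finsupp.degree_eq_sum, Finsupp.degree_eq_weight_one]
    exact hf (MvPolynomial.mem_support_iff.1 hα)
  rw [hdeg, hk.neg_one_pow, one_mul]

theorem IsInvariantB.exists_isHalfOf_isOfIndex {Q : CubatureRule n} (hQ : Q.IsInvariantB)
    (hS : Q.OnSphere) (hpos : Q.IsPositive) {k : ℕ} (hk : Even k) (hindex : Q.IsOfIndex k) :
    ∃ Q' : CubatureRule n, Q'.IsHalfOf Q ∧ Q'.OnSphere ∧ Q'.IsPositive ∧ Q'.IsOfIndex k := by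
  have hneg : ∀ x ∈ Q.nodes, -x ∈ Q.nodes ∧ Q.weight (-x) = Q.weight x := fun x hx ↦ by
    simpa only [signedPerm_one_neg_one] using hQ 1 (fun _ ↦ -1) x hx
  obtain ⟨Q', hhalf⟩ := exists_isHalfOf (fun h0 ↦ by simpa using hS 0 h0)
    fun x hx ↦ (hneg x hx).1
  refine ⟨Q', hhalf, fun x hx ↦ hS x (hhalf.1 hx), fun x hx ↦ ?_, fun f hf ↦ ?_⟩
  · rw [hhalf.2.2.2 x hx]
    exact mul_pos two_pos (hpos x (hhalf.1 hx))
  · rw [IsExactFor, hhalf.apply_eq (fun x hx ↦ (hneg x hx).2) (even_eval_of_isHomogeneous hf hk)]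
    exact hindex f hf

end HalfRules

end CubatureRule

section Orbits

open Nat

theorem card_image_comp_perm_mul_prod_factorial {α β : Type*} [Fintype α] [DecidableEq α]
    [DecidableEq β] {z : α → β} {T : Finset β} (hT : ∀ i, z i ∈ T) :
    (Finset.univ.image fun σ : Equiv.Perm α ↦ z ∘ σ).card *
      ∏ v ∈ T, (Finset.univ.filter fun i ↦ z i = v).card ! = (Fintype.card α)! := by
  have hfiber : ∀ w ∈ Finset.univ.image fun σ : Equiv.Perm α ↦ z ∘ σ,
      (Finset.univ.filter fun σ : Equiv.Perm α ↦ z ∘ σ = w).card =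
        ∏ v ∈ T, (Finset.univ.filter fun i ↦ z i = v).card ! := by
    intro w hw
    obtain ⟨τ, -, rfl⟩ := Finset.mem_image.1 hw
    have hcoset : (Finset.univ.filter fun σ : Equiv.Perm α ↦ z ∘ σ = z ∘ τ).card =
        (Finset.univ.filter fun ρ : Equiv.Perm α ↦ z ∘ ρ = z).card := by
      refine Finset.card_equiv (Equiv.mulRight τ⁻¹) fun σ ↦ ?_
      simp only [Finset.mem_filter, Finset.mem_univ, true_and, Equiv.coe_mulRight,
        Equiv.Perm.coe_mul, ← Function.comp_assoc, Equiv.Perm.inv_def, Equiv.comp_symm_eq]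
    rw [hcoset, ← Fintype.card_subtype, DomMulAct.stabilizer_card']
    simp only [Fintype.card_subtype]
    refine Finset.prod_subset (by simpa [Finset.subset_iff] using hT) fun v _ hv ↦ ?_
    rw [Finset.filter_eq_empty_iff.2 fun i _ hi ↦ hv (by simp [← hi]), Finset.card_empty,
      factorial_zero]
  rw [← Fintype.card_perm, ← Finset.card_univ,
    Finset.card_eq_sum_card_image (fun σ : Equiv.Perm α ↦ z ∘ σ),
    Finset.sum_congr rfl hfiber, Finset.sum_const, smul_eq_mul]

variable {n : ℕ} {x y : EuclideanSpace ℝ (Fin n)}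

theorem mem_orbitB_iff : y ∈ orbitB x ↔ ∃ σ ε, signedPerm σ ε x = y := by
  simp [orbitB]

theorem self_mem_orbitB (x : EuclideanSpace ℝ (Fin n)) : x ∈ orbitB x :=
  mem_orbitB_iff.2 ⟨1, 1, by ext; simp [signedPerm_apply]⟩

theorem mem_orbitB_iff_abs :
    y ∈ orbitB x ↔ ∃ σ : Equiv.Perm (Fin n), ∀ i, |y i| = |x (σ i)| := by
  rw [mem_orbitB_iff]
  refine exists_congr fun σ ↦ ⟨?_, fun h ↦ ?_⟩
  · rintro ⟨ε, rfl⟩ i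
    exact abs_signedPerm_apply σ ε x i
  · have hsign : ∀ i, ∃ u : ℤˣ, ((u : ℤ) : ℝ) * x (σ i) = y i := fun i ↦ by
      rcases abs_eq_abs.1 (h i) with hi | hi
      · exact ⟨1, by simp [hi]⟩
      · exact ⟨-1, by simp [hi]⟩
    choose ε hε using hsign
    exact ⟨ε, PiLp.ext hε⟩

theorem signedPerm_mem_orbitB_iff {σ : Equiv.Perm (Fin n)} {ε : Fin n → ℤˣ} :
    signedPerm σ ε y ∈ orbitB x ↔ y ∈ orbitB x := by
  simp only [mem_orbitB_iff_abs, abs_signedPerm_apply]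
  refine ⟨fun ⟨τ, h⟩ ↦ ⟨σ⁻¹.trans τ, fun i ↦ ?_⟩, fun ⟨τ, h⟩ ↦ ⟨σ.trans τ, fun i ↦ h (σ i)⟩⟩
  simpa using h (σ⁻¹ i)

theorem card_piFinset_self_neg (w : Fin n → ℝ) :
    (Fintype.piFinset fun i ↦ ({w i, -w i} : Finset ℝ)).card =
      2 ^ (Finset.univ.filter fun i ↦ w i ≠ 0).card := by
  have hfactor : ∀ i, ({w i, -w i} : Finset ℝ).card = if w i ≠ 0 then 2 else 1 := fun i ↦ by
    split_ifs with h
    · exact Finset.card_pair (self_ne_neg.2 h)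
    · simp [not_not.1 h]
  rw [Fintype.card_piFinset, Finset.prod_congr rfl fun i _ ↦ hfactor i, ← Finset.prod_filter,
    Finset.prod_const]

/-- Taking absolute values maps the orbit of `x` onto the rearrangements of `|x|`, and the fibres
consist of the sign changes. -/
theorem card_orbitB_mul_prod_factorial {T : Finset ℝ} (hT : ∀ i, |x i| ∈ T) :
    (orbitB x).card * ∏ v ∈ T, (Finset.univ.filter fun i ↦ |x i| = v).card ! =
      2 ^ (Finset.univ.filter fun i ↦ |x i| ≠ 0).card * n ! := by
  classical
  set rearrangements := Finset.univ.image fun σ : Equiv.Perm (Fin n) ↦ (fun i ↦ |x i|) ∘ σ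
  have hmaps : ∀ y ∈ orbitB x, (fun i ↦ |y i|) ∈ rearrangements := fun y hy ↦ by
    obtain ⟨σ, hσ⟩ := mem_orbitB_iff_abs.1 hy
    exact Finset.mem_image.2 ⟨σ, Finset.mem_univ σ, funext fun i ↦ (hσ i).symm⟩
  have hfiber : ∀ w ∈ rearrangements, ((orbitB x).filter fun y ↦ (fun i ↦ |y i|) = w).card =
      2 ^ (Finset.univ.filter fun i ↦ |x i| ≠ 0).card := by
    intro w hw
    obtain ⟨σ, -, rfl⟩ := Finset.mem_image.1 hw
    have hsupport : (Finset.univ.filter fun i ↦ |x (σ i)| ≠ 0).card =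
        (Finset.univ.filter fun i ↦ |x i| ≠ 0).card :=
      Finset.card_equiv σ fun i ↦ by simp
    rw [← hsupport, ← card_piFinset_self_neg]
    refine Finset.card_equiv (WithLp.equiv 2 _) fun y ↦ ?_
    simp only [Finset.mem_filter, mem_orbitB_iff_abs, funext_iff, Function.comp_apply,
      Fintype.mem_piFinset, Finset.mem_insert, Finset.mem_singleton, WithLp.equiv_apply,
      ← abs_eq_abs, abs_abs]
    exact ⟨fun h ↦ h.2, fun h ↦ ⟨⟨σ, h⟩, h⟩⟩
  have hrearrangements := card_image_comp_perm_mul_prod_factorial (z := fun i ↦ |x i|) hT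
  rw [Finset.card_eq_sum_card_fiberwise hmaps, Finset.sum_congr rfl hfiber, Finset.sum_const,
    smul_eq_mul, mul_right_comm, hrearrangements, Fintype.card_fin, mul_comm]

theorem card_filter_val_lt_of_le {k : ℕ} (hk : k ≤ n) :
    (Finset.univ.filter fun i : Fin n ↦ (i : ℕ) < k).card = k := by
  rw [Fin.card_filter_val_lt, min_eq_right hk]

theorem card_filter_not_val_lt_of_le {k : ℕ} (hk : k ≤ n) :
    (Finset.univ.filter fun i : Fin n ↦ ¬ (i : ℕ) < k).card = n - k := by
  rw [Finset.filter_not, Finset.card_sdiff_of_subset (Finset.filter_subset _ _),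
    card_filter_val_lt_of_le hk, Finset.card_fin]

theorem abs_nodeV (n k : ℕ) (i : Fin n) :
    |nodeV n k i| = if (i : ℕ) < k then 1 / √(k : ℝ) else 0 :=
  abs_of_nonneg (by simp only [nodeV]; split_ifs <;> positivity)

theorem card_orbitB_nodeV {k : ℕ} (hk : 1 ≤ k) (hkn : k ≤ n) :
    (orbitB (nodeV n k)).card = 2 ^ k * n.choose k := by
  have hc : 1 / √(k : ℝ) ≠ 0 := by positivity
  have h := card_orbitB_mul_prod_factorial (x := nodeV n k) (T := {1 / √(k : ℝ), 0})
    fun i ↦ by rw [abs_nodeV]; split_ifs <;> simp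
  rw [Finset.prod_pair hc] at h
  simp only [abs_nodeV, ite_eq_left_iff, hc.symm, hc, imp_false, not_not, ne_eq,
    ite_eq_right_iff, card_filter_val_lt_of_le hkn, card_filter_not_val_lt_of_le hkn,
    ← choose_mul_factorial_mul_factorial hkn] at h
  refine Nat.eq_of_mul_eq_mul_right (mul_pos (factorial_pos k) (factorial_pos (n - k))) ?_
  rw [h, mul_assoc, mul_assoc]

theorem sqrt_div_ne_one_div_sqrt {a b : ℝ} (ha : a ≠ 1) (hb : 0 < b) : √(a / b) ≠ 1 / √b := by
  rw [Real.sqrt_div' _ hb.le, ne_eq, div_left_inj' (Real.sqrt_pos.2 hb).ne']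
  simpa using ha

theorem abs_nodeU_zero (d p : ℕ) (a : ℝ) : |nodeU (d + 1) p a 0| = √(a / (a + p)) :=
  abs_of_nonneg (Real.sqrt_nonneg _)

theorem abs_nodeU_succ {d : ℕ} (p : ℕ) (a : ℝ) (i : Fin d) :
    |nodeU (d + 1) p a i.succ| = if (i : ℕ) < p then 1 / √(a + p) else 0 :=
  abs_of_nonneg (by simp only [nodeU]; split_ifs <;> positivity)

theorem card_orbitB_nodeU {d p : ℕ} {a : ℝ} (ha : 0 < a) (ha1 : a ≠ 1) (hp : p ≤ d) :
    (orbitB (nodeU (d + 1) p a)).card = 2 ^ (p + 1) * (d + 1) * d.choose p := by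
  set A := √(a / (a + p)) with hA
  set B := 1 / √(a + p) with hB
  have hA0 : A ≠ 0 := by positivity
  have hB0 : B ≠ 0 := by positivity
  have hAB : A ≠ B := sqrt_div_ne_one_div_sqrt ha1 (by positivity)
  have hfirst : (Finset.univ.filter fun i : Fin d ↦ (if (i : ℕ) < p then B else 0) = A).card = 0 :=
    Finset.card_eq_zero.2 (Finset.filter_eq_empty_iff.2 fun i _ ↦ by
      split_ifs
      exacts [hAB.symm, hA0.symm])
  have h := card_orbitB_mul_prod_factorial (x := nodeU (d + 1) p a) (T := {A, B, 0})
    (Fin.cases (by simp [abs_nodeU_zero, hA]) fun i ↦ by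
      rw [abs_nodeU_succ]; split_ifs <;> simp [hB])
  rw [Finset.prod_insert (by simp [hAB, hA0]), Finset.prod_pair hB0] at h
  simp only [Fin.card_filter_univ_succ, abs_nodeU_zero, abs_nodeU_succ, ← hA, ← hB] at h
  simp only [ne_eq, hA0, hB0, hAB, hB0.symm, ite_eq_left_iff, ite_eq_right_iff, imp_false,
    not_not, hfirst, card_filter_val_lt_of_le hp, card_filter_not_val_lt_of_le hp, if_true,
    if_false, not_false_eq_true, zero_add, factorial_one, one_mul, factorial_succ d,
    ← choose_mul_factorial_mul_factorial hp] at h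
  refine Nat.eq_of_mul_eq_mul_right (mul_pos (factorial_pos p) (factorial_pos (d - p))) ?_
  rw [h]
  ring

end Orbits

namespace CubatureRule

open MvPolynomial Finset
open scoped Nat

variable {n : ℕ} [NeZero n]

theorem polynomialMean_prod_X_pow_two_mul (β : Fin n → ℕ) :
    polynomialMean n (∏ i, X i ^ (2 * β i)) =
      (∏ i, ((2 * β i - 1)‼ : ℝ)) / ∏ j ∈ range (∑ i, β i), ((n : ℝ) + 2 * j) := by
  rw [← sphereMean_prod_pow_two_mul]
  simp [polynomialMean]

theorem polynomialMean_X_pow_two_mul (i : Fin n) (k : ℕ) :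
    polynomialMean n (X i ^ (2 * k)) =
      ((2 * k - 1)‼ : ℝ) / ∏ j ∈ range k, ((n : ℝ) + 2 * j) := by
  have h := polynomialMean_prod_X_pow_two_mul (Pi.single i k)
  have hX : ∏ j, (X j : MvPolynomial (Fin n) ℝ) ^ (2 * Pi.single i k j) = X i ^ (2 * k) := by
    rw [Fintype.prod_eq_single i fun j hj ↦ by simp [hj], Pi.single_eq_same]
  rwa [hX, Fintype.prod_eq_single i fun j hj ↦ by simp [hj], Pi.single_eq_same,
    Fintype.sum_pi_single'] at h

theorem polynomialMean_X_pow_mul_X_pow {i j : Fin n} (hij : i ≠ j) (k l : ℕ) :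
    polynomialMean n (X i ^ (2 * k) * X j ^ (2 * l)) =
      ((2 * k - 1)‼ * (2 * l - 1)‼ : ℝ) / ∏ j ∈ range (k + l), ((n : ℝ) + 2 * j) := by
  set β : Fin n → ℕ := Pi.single i k + Pi.single j l with hβ
  have hi : β i = k := by simp [hβ, hij]
  have hj : β j = l := by simp [hβ, hij.symm]
  have hne : ∀ v, v ≠ i ∧ v ≠ j → β v = 0 := fun v hv ↦ by simp [hβ, hv]
  have h := polynomialMean_prod_X_pow_two_mul β
  rw [Fintype.prod_eq_mul i j hij fun v hv ↦ by simp [hne v hv],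
    Fintype.prod_eq_mul i j hij fun v hv ↦ by simp [hne v hv], hi, hj] at h
  rw [h]
  simp [hβ, sum_add_distrib]

theorem polynomialMean_psum (k : ℕ) :
    polynomialMean n (psum (Fin n) ℝ (2 * k)) =
      n * ((2 * k - 1)‼ / ∏ j ∈ range k, ((n : ℝ) + 2 * j)) := by
  simp [psum, polynomialMean_X_pow_two_mul]

theorem polynomialMean_psum_mul_psum (k l : ℕ) :
    polynomialMean n (psum (Fin n) ℝ (2 * k) * psum (Fin n) ℝ (2 * l)) =
      n * (((2 * (k + l) - 1)‼ + (n - 1) * ((2 * k - 1)‼ * (2 * l - 1)‼)) /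
        ∏ j ∈ range (k + l), ((n : ℝ) + 2 * j)) := by
  have hrow : ∀ i : Fin n, ∑ j, polynomialMean n (X i ^ (2 * k) * X j ^ (2 * l)) =
      ((2 * (k + l) - 1)‼ + (n - 1) * ((2 * k - 1)‼ * (2 * l - 1)‼)) /
        ∏ j ∈ range (k + l), ((n : ℝ) + 2 * j) := by
    intro i
    rw [← add_sum_erase _ _ (mem_univ i), ← pow_add, ← mul_add, polynomialMean_X_pow_two_mul,
      sum_congr rfl fun j hj ↦ polynomialMean_X_pow_mul_X_pow (ne_of_mem_erase hj).symm k l,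
      sum_const, card_erase_of_mem (mem_univ i), Finset.card_fin, nsmul_eq_mul,
      Nat.cast_pred (NeZero.pos n)]
    ring
  simp only [psum, sum_mul_sum, map_sum, hrow, sum_const, Finset.card_fin, nsmul_eq_mul]

end CubatureRule

section Generators

open MvPolynomial

variable {n d p m : ℕ} {a : ℝ}

theorem eval_psum_two_mul_signedPerm (σ : Equiv.Perm (Fin n)) (ε : Fin n → ℤˣ)
    (x : EuclideanSpace ℝ (Fin n)) (k : ℕ) :
    eval (fun i ↦ signedPerm σ ε x i) (psum (Fin n) ℝ (2 * k)) =
      eval (fun i ↦ x i) (psum (Fin n) ℝ (2 * k)) := by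
  simp only [psum, map_sum, map_pow, eval_X, pow_mul, ← sq_abs (signedPerm _ _ _ _),
    abs_signedPerm_apply]
  simpa only [sq_abs] using Equiv.sum_comp σ fun i ↦ (x i ^ 2) ^ k

theorem eval_psum_nodeV {r : ℕ} (hr : 1 ≤ r) (hrn : r ≤ n) (k : ℕ) :
    eval (fun i ↦ nodeV n r i) (psum (Fin n) ℝ (2 * (k + 1))) = (1 / (r : ℝ)) ^ k := by
  have hterm : ∀ i : Fin n, nodeV n r i ^ (2 * (k + 1)) =
      if (i : ℕ) < r then (1 / (r : ℝ)) ^ (k + 1) else 0 := fun i ↦ by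
    rw [pow_mul, ← sq_abs, abs_nodeV]
    split_ifs
    · rw [div_pow, Real.sq_sqrt (Nat.cast_nonneg r), one_pow]
    · simp
  simp only [psum, map_sum, map_pow, eval_X, hterm]
  rw [← Finset.sum_filter, Finset.sum_const, card_filter_val_lt_of_le hrn, nsmul_eq_mul,
    pow_succ', ← mul_assoc, mul_one_div_cancel (by positivity), one_mul]

theorem eval_psum_nodeU (ha : 0 ≤ a) (hp : p ≤ d) (k : ℕ) :
    eval (fun i ↦ nodeU (d + 1) p a i) (psum (Fin (d + 1)) ℝ (2 * (k + 1))) =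
      (a ^ (k + 1) + p) / (a + p) ^ (k + 1) := by
  have hterm : ∀ i : Fin d, nodeU (d + 1) p a i.succ ^ (2 * (k + 1)) =
      if (i : ℕ) < p then (1 / (a + p)) ^ (k + 1) else 0 := fun i ↦ by
    rw [pow_mul, ← sq_abs, abs_nodeU_succ]
    split_ifs
    · rw [div_pow, Real.sq_sqrt (by positivity), one_pow]
    · simp
  simp only [psum, map_sum, map_pow, eval_X]
  rw [Fin.sum_univ_succ, Finset.sum_congr rfl fun i _ ↦ hterm i, ← Finset.sum_filter,
    Finset.sum_const, card_filter_val_lt_of_le hp, nsmul_eq_mul, pow_mul, ← sq_abs,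
    abs_nodeU_zero, Real.sq_sqrt (by positivity), div_pow, div_pow, one_pow]
  ring

/-- The power sums `∑ xᵢ ^ (2 * (k + 1))` of the six generators, over any field so that they can
be evaluated over `ℚ`. -/
def generatorPowerSum {K : Type*} [Field K] (d p m : ℕ) (a : K) (k : ℕ) : Fin 6 → K :=
  ![(1 / ((d : K) + 1)) ^ k, 1, (1 / 2) ^ k, (1 / 3) ^ k, (1 / (m : K)) ^ k,
    (a ^ (k + 1) + p) / (a + p) ^ (k + 1)]

/-- The range of the parameters in which the six orbits are defined, have the sizes `orbitSize`
and lie on the sphere. -/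
structure AdmissibleParameters (d p m : ℕ) (a : ℝ) : Prop where
  two_le : 2 ≤ d
  le : p ≤ d
  one_le : 1 ≤ m
  le_succ : m ≤ d + 1
  pos : 0 < a
  ne_one : a ≠ 1

namespace AdmissibleParameters

theorem eval_psum_generator (h : AdmissibleParameters d p m a) (k : ℕ) (j : Fin 6) :
    eval (fun i ↦ generator d p m a j i) (psum (Fin (d + 1)) ℝ (2 * (k + 1))) =
      generatorPowerSum d p m a k j := by
  have hd := h.two_le
  fin_cases j
  · exact (eval_psum_nodeV (by omega) le_rfl k).trans (by simp [generatorPowerSum])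
  · exact (eval_psum_nodeV le_rfl (by omega) k).trans (by simp [generatorPowerSum])
  · exact (eval_psum_nodeV (by omega) (by omega) k).trans (by simp [generatorPowerSum])
  · exact (eval_psum_nodeV (by omega) (by omega) k).trans (by simp [generatorPowerSum])
  · exact eval_psum_nodeV h.one_le h.le_succ k
  · exact eval_psum_nodeU h.pos.le h.le k

theorem generatorPowerSum_zero (h : AdmissibleParameters d p m a) (j : Fin 6) :
    generatorPowerSum d p m a 0 j = 1 := by
  have hap : a + p ≠ 0 := by have := h.pos; positivity
  fin_cases j <;> simp [generatorPowerSum, hap]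

theorem norm_generator (h : AdmissibleParameters d p m a) (j : Fin 6) :
    ‖generator d p m a j‖ = 1 := by
  have hsum := h.eval_psum_generator 0 j
  simp only [h.generatorPowerSum_zero, psum, map_sum, map_pow, eval_X] at hsum
  rw [EuclideanSpace.norm_eq]
  simpa using hsum

theorem card_orbitB_generator (h : AdmissibleParameters d p m a) (j : Fin 6) :
    (orbitB (generator d p m a j)).card = orbitSize d p m j := by
  have hd := h.two_le
  fin_cases j
  · exact (card_orbitB_nodeV (by omega) le_rfl).trans (by simp [orbitSize])
  · exact (card_orbitB_nodeV le_rfl (by omega)).trans (by simp [orbitSize])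
  · exact card_orbitB_nodeV (by omega) (by omega)
  · exact card_orbitB_nodeV (by omega) (by omega)
  · exact card_orbitB_nodeV h.one_le h.le_succ
  · exact card_orbitB_nodeU h.pos h.ne_one h.le

theorem orbitSize_pos (h : AdmissibleParameters d p m a) (j : Fin 6) :
    (0 : ℝ) < orbitSize d p m j := by
  rw [← h.card_orbitB_generator j, Nat.cast_pos]
  exact Finset.card_pos.2 ⟨_, self_mem_orbitB _⟩

end AdmissibleParameters

end Generators

section SixOrbitRule

open MvPolynomial

variable {d p m : ℕ} {a : ℝ} {lam : Fin 6 → ℝ}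

theorem mem_sixOrbitRule_nodes {x : EuclideanSpace ℝ (Fin (d + 1))} :
    x ∈ (sixOrbitRule d p m a lam).nodes ↔ ∃ j, lam j ≠ 0 ∧ x ∈ orbitB (generator d p m a j) := by
  simp [sixOrbitRule]

theorem sixOrbitRule_apply (f : EuclideanSpace ℝ (Fin (d + 1)) → ℝ) :
    (sixOrbitRule d p m a lam).apply f =
      ∑ j, lam j / orbitSize d p m j * ∑ x ∈ orbitB (generator d p m a j), f x := by
  classical
  simp only [CubatureRule.apply, sixOrbitRule, Finset.sum_mul, ite_mul, zero_mul]
  rw [Finset.sum_comm]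
  refine Finset.sum_congr rfl fun j _ ↦ ?_
  by_cases hj : lam j = 0
  · simp [hj]
  rw [← Finset.sum_filter, Finset.mul_sum]
  refine Finset.sum_congr (Finset.ext fun x ↦ ?_) fun _ _ ↦ rfl
  simp only [Finset.mem_filter, Finset.mem_biUnion, Finset.mem_univ, true_and]
  exact ⟨And.right, fun hx ↦ ⟨⟨j, hj, hx⟩, hx⟩⟩

theorem sixOrbitRule_isInvariantB : (sixOrbitRule d p m a lam).IsInvariantB := by
  intro σ ε x hx
  rw [mem_sixOrbitRule_nodes] at hx ⊢
  simpa only [sixOrbitRule, signedPerm_mem_orbitB_iff, and_true] using hx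

namespace AdmissibleParameters

theorem apply_sixOrbitRule (h : AdmissibleParameters d p m a)
    {f : EuclideanSpace ℝ (Fin (d + 1)) → ℝ} (hf : ∀ σ ε x, f (signedPerm σ ε x) = f x) :
    (sixOrbitRule d p m a lam).apply f = ∑ j, lam j * f (generator d p m a j) := by
  rw [sixOrbitRule_apply]
  refine Finset.sum_congr rfl fun j _ ↦ ?_
  have hconst : ∀ x ∈ orbitB (generator d p m a j), f x = f (generator d p m a j) := by
    intro x hx
    obtain ⟨σ, ε, rfl⟩ := mem_orbitB_iff.1 hx
    exact hf σ ε _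
  rw [Finset.sum_congr rfl hconst, Finset.sum_const, h.card_orbitB_generator, nsmul_eq_mul,
    ← mul_assoc, div_mul_cancel₀ _ (h.orbitSize_pos j).ne']

theorem onSphere (h : AdmissibleParameters d p m a) : (sixOrbitRule d p m a lam).OnSphere := by
  intro x hx
  obtain ⟨j, -, hx⟩ := mem_sixOrbitRule_nodes.1 hx
  obtain ⟨σ, ε, rfl⟩ := mem_orbitB_iff.1 hx
  rw [norm_signedPerm, h.norm_generator]

theorem isPositive (h : AdmissibleParameters d p m a) (hlam : ∀ j, 0 ≤ lam j) :
    (sixOrbitRule d p m a lam).IsPositive := by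
  intro x hx
  obtain ⟨j, hj, hx⟩ := mem_sixOrbitRule_nodes.1 hx
  simp only [sixOrbitRule]
  refine Finset.sum_pos' (fun i _ ↦ ?_) ⟨j, Finset.mem_univ j, ?_⟩
  · split_ifs
    exacts [div_nonneg (hlam i) (h.orbitSize_pos i).le, le_rfl]
  · rw [if_pos hx]
    exact div_pos ((hlam j).lt_of_ne hj.symm) (h.orbitSize_pos j)

theorem error_psum (h : AdmissibleParameters d p m a) (k : ℕ) :
    (sixOrbitRule d p m a lam).error (psum (Fin (d + 1)) ℝ (2 * (k + 1))) =
      CubatureRule.polynomialMean (d + 1) (psum (Fin (d + 1)) ℝ (2 * (k + 1))) -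
        ∑ j, lam j * generatorPowerSum d p m a k j := by
  rw [CubatureRule.error_apply, h.apply_sixOrbitRule fun σ ε x ↦
    eval_psum_two_mul_signedPerm σ ε x (k + 1)]
  simp only [h.eval_psum_generator]

theorem error_psum_mul_psum (h : AdmissibleParameters d p m a) (k l : ℕ) :
    (sixOrbitRule d p m a lam).error
        (psum (Fin (d + 1)) ℝ (2 * (k + 1)) * psum (Fin (d + 1)) ℝ (2 * (l + 1))) =
      CubatureRule.polynomialMean (d + 1)
          (psum (Fin (d + 1)) ℝ (2 * (k + 1)) * psum (Fin (d + 1)) ℝ (2 * (l + 1))) -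
        ∑ j, lam j * (generatorPowerSum d p m a k j * generatorPowerSum d p m a l j) := by
  rw [CubatureRule.error_apply, h.apply_sixOrbitRule fun σ ε x ↦ by
    simp only [eval_mul, eval_psum_two_mul_signedPerm]]
  simp only [eval_mul, h.eval_psum_generator]

end AdmissibleParameters

end SixOrbitRule

open scoped Nat in
/-- Equations for the parameters and the coefficients of a six-orbit rule that give it degree at
least 11, over any field so that they can be checked over `ℚ`. Exactness for the power sums of
degree at most 10 is `moment`; exactness for the two products of power sums that matter is replaced
by `ratio`, which fixes `a`, and `sixth`. -/
structure MomentEquations {K : Type*} [Field K] (d p m : ℕ) (a : K) (lam : Fin 6 → K) : Prop where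
  moment : ∀ k < 5, ∑ j, lam j * generatorPowerSum d p m a k j =
    (2 * k + 1)‼ / ∏ j ∈ Finset.range k, ((d : K) + 3 + 2 * j)
  ratio : 10 * (a + p) = (a + 1) * (d + 9)
  sixth : lam 5 = (a + p) ^ 5 *
    (60 * d / (p * a * (a - 1) ^ 2 * (a + 1) * (d + 9) * (d + 7) * (d + 5) * (d + 3)))

/-- On the first five orbits `s₂ₖ₊₄ = s₂ₖ₊₂ * s₄`, where `sₖ` is the `k`-th power sum, so the
difference of the two only sees the sixth orbit. -/
theorem sum_mul_generatorPowerSum_mul {K : Type*} [Field K] {d p : ℕ} {a : K} (hap : a + p ≠ 0)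
    (m : ℕ) (lam : Fin 6 → K) (k : ℕ) :
    ∑ j, lam j * (generatorPowerSum d p m a k j * generatorPowerSum d p m a 1 j) =
      ∑ j, lam j * generatorPowerSum d p m a (k + 1) j -
        lam 5 * (p * a * (a - 1) * (a ^ k - 1) / (a + p) ^ (k + 3)) := by
  have hsixth : (a ^ (k + 1) + p) / (a + p) ^ (k + 1) * ((a ^ 2 + p) / (a + p) ^ 2) =
      (a ^ (k + 2) + p) / (a + p) ^ (k + 2) -
        p * a * (a - 1) * (a ^ k - 1) / (a + p) ^ (k + 3) := by
    field_simp
    ring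
  simp only [Fin.sum_univ_six, generatorPowerSum, Matrix.cons_val, pow_one, ← pow_succ, mul_one]
  norm_num only [hsixth]
  ring

section DegreeEleven

open MvPolynomial

open scoped Nat

variable {d p m : ℕ} {a : ℝ} {lam : Fin 6 → ℝ}

theorem CubatureRule.polynomialMean_psum_succ (d k : ℕ) :
    polynomialMean (d + 1) (psum (Fin (d + 1)) ℝ (2 * (k + 1))) =
      (2 * k + 1)‼ / ∏ j ∈ Finset.range k, ((d : ℝ) + 3 + 2 * j) := by
  have hshift : ∏ j ∈ Finset.range k, ((d : ℝ) + 1 + 2 * (j + 1 : ℕ)) =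
      ∏ j ∈ Finset.range k, ((d : ℝ) + 3 + 2 * j) :=
    Finset.prod_congr rfl fun j _ ↦ by push_cast; ring
  rw [polynomialMean_psum, Finset.prod_range_succ', Nat.cast_succ d, hshift]
  have hpos : ∏ j ∈ Finset.range k, ((d : ℝ) + 3 + 2 * j) ≠ 0 :=
    Finset.prod_ne_zero_iff.2 fun j _ ↦ by positivity
  simp only [Nat.cast_zero, mul_zero, add_zero, show 2 * (k + 1) - 1 = 2 * k + 1 by omega]
  field_simp

namespace AdmissibleParameters

theorem error_psum_eq_zero (h : AdmissibleParameters d p m a) (he : MomentEquations d p m a lam)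
    {k : ℕ} (hk : k < 5) :
    (sixOrbitRule d p m a lam).error (psum (Fin (d + 1)) ℝ (2 * (k + 1))) = 0 := by
  rw [h.error_psum, CubatureRule.polynomialMean_psum_succ, he.moment k hk, sub_self]

theorem error_one_eq_zero (h : AdmissibleParameters d p m a) (he : MomentEquations d p m a lam) :
    (sixOrbitRule d p m a lam).error 1 = 0 := by
  rw [← h.error_psum_eq_zero he (show 0 < 5 by norm_num)]
  exact h.onSphere.error_congr fun x hx ↦ by
    rw [map_one, zero_add, mul_one, eval_psum_two_of_norm_eq_one hx]

theorem sum_eq_one (h : AdmissibleParameters d p m a) (he : MomentEquations d p m a lam) :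
    ∑ j, lam j = 1 := by
  simpa [h.generatorPowerSum_zero] using he.moment 0 (by norm_num)

theorem p_ne_zero (h : AdmissibleParameters d p m a) (hr : 10 * (a + p) = (a + 1) * (d + 9)) :
    p ≠ 0 := by
  rintro rfl
  have ha := h.pos
  have hd : (2 : ℝ) ≤ d := by exact_mod_cast h.two_le
  have := mul_le_mul_of_nonneg_left hd (by positivity : 0 ≤ a + 1)
  push_cast at hr
  linarith

theorem error_psum_mul_psum_four_eq_zero (h : AdmissibleParameters d p m a)
    (he : MomentEquations d p m a lam) {k : ℕ} (hk : 1 ≤ k) (hk' : k ≤ 2) :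
    (sixOrbitRule d p m a lam).error
      (psum (Fin (d + 1)) ℝ (2 * (k + 1)) * psum (Fin (d + 1)) ℝ 4) = 0 := by
  have ha := h.pos
  have ha1 : a - 1 ≠ 0 := sub_ne_zero.2 h.ne_one
  have hp : (p : ℝ) ≠ 0 := Nat.cast_ne_zero.2 (h.p_ne_zero he.ratio)
  have hap : a + p = (a + 1) * (d + 9) / 10 := by linarith [he.ratio]
  have hap0 : a + p ≠ 0 := by positivity
  have hpair := h.error_psum_mul_psum (lam := lam) k 1
  rw [sum_mul_generatorPowerSum_mul hap0, he.moment _ (by omega), he.sixth,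
    CubatureRule.polynomialMean_psum_mul_psum] at hpair
  refine hpair.trans ?_
  interval_cases k <;>
    norm_num [Finset.prod_range_succ, Nat.doubleFactorial, hap] <;> field_simp <;> ring

theorem isExactFor_of_totalDegree_le (h : AdmissibleParameters d p m a)
    (he : MomentEquations d p m a lam) {f : MvPolynomial (Fin (d + 1)) ℝ}
    (hf : f.totalDegree ≤ 11) : (sixOrbitRule d p m a lam).IsExactFor f := by
  refine sixOrbitRule_isInvariantB.isExactFor_of_totalDegree_le_eleven h.onSphere
    (h.error_one_eq_zero he) (fun k hk hk5 ↦ ?_) (fun k hk hk3 ↦ ?_) hf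
  · obtain ⟨k, rfl⟩ := Nat.exists_eq_succ_of_ne_zero (by omega : k ≠ 0)
    exact h.error_psum_eq_zero he hk5
  · obtain ⟨k, rfl⟩ := Nat.exists_eq_succ_of_ne_zero (by omega : k ≠ 0)
    exact h.error_psum_mul_psum_four_eq_zero he (by omega) (by omega)

end AdmissibleParameters

end DegreeEleven

section DegreeTwelve

open MvPolynomial

variable {n d p m : ℕ} {a : ℝ} {lam : Fin 6 → ℝ}

/-- The homogeneous polynomial of degree 12 which shows that a six-orbit rule does not have degree
12: the ratio of two nonzero squared coordinates of a node is `1`, `a` or `1 / a`. -/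
noncomputable def nodalPolynomial (i j : Fin n) (a : ℝ) : MvPolynomial (Fin n) ℝ :=
  X i ^ 2 * X j ^ 2 * (X i ^ 2 - X j ^ 2) ^ 2 * (X i ^ 2 - C a * X j ^ 2) *
    (X j ^ 2 - C a * X i ^ 2)

theorem isHomogeneous_nodalPolynomial (i j : Fin n) (a : ℝ) :
    (nodalPolynomial i j a).IsHomogeneous 12 := by
  have hX : ∀ k : Fin n, (X k ^ 2 : MvPolynomial (Fin n) ℝ).IsHomogeneous 2 := fun k ↦
    (isHomogeneous_X ℝ k).pow 2
  exact ((((hX i).mul (hX j)).mul (((hX i).sub (hX j)).pow 2)).mul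
    ((hX i).sub ((hX j).C_mul a))).mul ((hX j).sub ((hX i).C_mul a))

theorem polynomialMean_nodalPolynomial [NeZero n] {i j : Fin n} (hij : i ≠ j) (a : ℝ) :
    CubatureRule.polynomialMean n (nodalPolynomial i j a) =
      180 * (a ^ 2 - 6 * a + 1) / ∏ k ∈ Finset.range 6, ((n : ℝ) + 2 * k) := by
  have hexpand : nodalPolynomial i j a =
      C (-a) * (X i ^ (2 * 5) * X j ^ (2 * 1) + X i ^ (2 * 1) * X j ^ (2 * 5)) +
      C ((1 + a) ^ 2) * (X i ^ (2 * 4) * X j ^ (2 * 2) + X i ^ (2 * 2) * X j ^ (2 * 4)) +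
      C (-2 * (1 + a + a ^ 2)) * (X i ^ (2 * 3) * X j ^ (2 * 3)) := by
    simp only [nodalPolynomial, C_neg, C_add, C_mul, C_pow, C_1, map_ofNat]
    ring
  simp only [hexpand, C_mul', map_add, map_smul, smul_eq_mul,
    CubatureRule.polynomialMean_X_pow_mul_X_pow hij]
  norm_num [Nat.doubleFactorial]
  ring

theorem exists_sq_generator_eq (ha : 0 ≤ a) (j : Fin 6) :
    ∃ c : ℝ, ∀ i, generator d p m a j i ^ 2 = 0 ∨ generator d p m a j i ^ 2 = c ∨
      generator d p m a j i ^ 2 = a * c := by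
  have hV : ∀ k, ∃ c : ℝ, ∀ i, nodeV (d + 1) k i ^ 2 = 0 ∨ nodeV (d + 1) k i ^ 2 = c ∨
      nodeV (d + 1) k i ^ 2 = a * c := fun k ↦
    ⟨(1 / √k) ^ 2, fun i ↦ by rw [nodeV]; dsimp only; split_ifs <;> simp⟩
  have hU : ∃ c : ℝ, ∀ i, nodeU (d + 1) p a i ^ 2 = 0 ∨ nodeU (d + 1) p a i ^ 2 = c ∨
      nodeU (d + 1) p a i ^ 2 = a * c :=
    ⟨1 / (a + p), fun i ↦ by
      rw [nodeU]
      dsimp only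
      split_ifs
      · exact .inr (.inr (by rw [Real.sq_sqrt (by positivity)]; ring))
      · exact .inr (.inl (by rw [div_pow, Real.sq_sqrt (by positivity), one_pow]))
      · simp⟩
  fin_cases j
  exacts [hV _, hV _, hV _, hV _, hV _, hU]

theorem eval_nodalPolynomial_eq_zero (ha : 0 ≤ a) {x : EuclideanSpace ℝ (Fin (d + 1))}
    (hx : x ∈ (sixOrbitRule d p m a lam).nodes) (i j : Fin (d + 1)) :
    eval (fun k ↦ x k) (nodalPolynomial i j a) = 0 := by
  obtain ⟨l, -, hl⟩ := mem_sixOrbitRule_nodes.1 hx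
  obtain ⟨σ, ε, rfl⟩ := mem_orbitB_iff.1 hl
  obtain ⟨c, hc⟩ := exists_sq_generator_eq (d := d) (p := p) (m := m) ha l
  simp only [nodalPolynomial, map_mul, map_sub, map_pow, eval_X, eval_C,
    ← sq_abs (signedPerm _ _ _ _), abs_signedPerm_apply, sq_abs]
  rcases hc (σ i) with hi | hi | hi <;> rcases hc (σ j) with hj | hj | hj <;> rw [hi, hj] <;> ring

theorem sixOrbitRule_not_isExactFor_nodalPolynomial (ha : 0 ≤ a) (haq : a ^ 2 - 6 * a + 1 ≠ 0)
    {i j : Fin (d + 1)} (hij : i ≠ j) :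
    ¬ (sixOrbitRule d p m a lam).IsExactFor (nodalPolynomial i j a) := by
  have hmean : CubatureRule.polynomialMean (d + 1) (nodalPolynomial i j a) ≠ 0 := by
    rw [polynomialMean_nodalPolynomial hij]
    have : ∏ k ∈ Finset.range 6, (((d + 1 : ℕ) : ℝ) + 2 * k) ≠ 0 :=
      Finset.prod_ne_zero_iff.2 fun k _ ↦ by positivity
    positivity
  rw [CubatureRule.isExactFor_iff_error_eq_zero, CubatureRule.error_apply, CubatureRule.apply,
    Finset.sum_eq_zero fun x hx ↦ by rw [eval_nodalPolynomial_eq_zero ha hx, mul_zero], sub_zero]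
  exact hmean

end DegreeTwelve

theorem AdmissibleParameters.isPositiveInvariantOfDegreeEleven {d p m : ℕ} {a : ℝ}
    {lam : Fin 6 → ℝ} (h : AdmissibleParameters d p m a) (he : MomentEquations d p m a lam)
    (hlam : ∀ j, 0 ≤ lam j) (haq : a ^ 2 - 6 * a + 1 ≠ 0) :
    (sixOrbitRule d p m a lam).IsPositiveInvariantOfDegreeEleven := by
  have hexact : ∀ f : MvPolynomial (Fin (d + 1)) ℝ, f.totalDegree ≤ 11 →
      (sixOrbitRule d p m a lam).IsExactFor f := fun f ↦ h.isExactFor_of_totalDegree_le he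
  have h01 : (0 : Fin (d + 1)) ≠ Fin.last d := by
    have := h.two_le
    simp [Fin.ext_iff]
    omega
  exact ⟨h.onSphere, h.isPositive hlam, sixOrbitRule_isInvariantB,
    ⟨hexact, nodalPolynomial 0 (Fin.last d) a,
      (isHomogeneous_nodalPolynomial _ _ a).totalDegree_le,
      sixOrbitRule_not_isExactFor_nodalPolynomial h.pos.le haq h01⟩,
    sixOrbitRule_isInvariantB.exists_isHalfOf_isOfIndex h.onSphere (h.isPositive hlam)
      (by decide) fun f hf ↦ hexact f (hf.totalDegree_le.trans (by norm_num))⟩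

theorem rat_sq_sub_six_mul_add_one_ne_zero (q : ℚ) : q ^ 2 - 6 * q + 1 ≠ 0 := by
  intro h
  have hsq : IsSquare (8 : ℚ) := ⟨q - 3, by linear_combination -h⟩
  obtain ⟨r, hr⟩ := Rat.isSquare_ofNat_iff.1 hsq
  have hr3 : r < 3 := by nlinarith
  interval_cases r <;> omega

section MapField

variable {K L : Type*} [Field K] [Field L] (φ : K →+* L) {d p m : ℕ} {a : K}

theorem generatorPowerSum_map (k : ℕ) (j : Fin 6) :
    generatorPowerSum d p m (φ a) k j = φ (generatorPowerSum d p m a k j) := by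
  fin_cases j <;> simp [generatorPowerSum, map_ofNat φ]

theorem MomentEquations.map {lam : Fin 6 → K} (h : MomentEquations d p m a lam) :
    MomentEquations d p m (φ a) (φ ∘ lam) where
  moment k hk := by
    simpa [generatorPowerSum_map, map_ofNat φ] using congrArg φ (h.moment k hk)
  ratio := by simpa [map_ofNat φ] using congrArg φ h.ratio
  sixth := by simpa [map_ofNat φ] using congrArg φ h.sixth

end MapField

section Table

variable {d p m : ℕ}

/-- The coefficients of the rules in dimensions `3 ≤ d ≤ 23`. They are found from
`MomentEquations`: the last one is explicit, and the others solve a Vandermonde system in `1 / r`,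
where `r` is the number of ones of the generator. For `d = 3` the first and the fifth orbit
coincide, and the fifth is left out. -/
def orbitWeights : ℕ → Fin 6 → ℚ
  | 3 => ![2/15, 1/15, 1/8, 0, 0, 27/40]
  | 4 => ![625/9009, 860/27027, 1088/9009, 2700/17017, 40448/441441, 913952/1731807]
  | 5 => ![27/280, 19/840, 1/14, 27/896, 16/189, 2401/3456]
  | 6 => ![2401/28080, 805/61776, 136/2145, 135/2288, 3968/19305, 6561/11440]
  | 7 => ![32/315, 1/105, 2/45, 0, 2/15, 32/45]
  | 8 => ![277749/4108390, 886833/143793650, 17216/560235, 159516/2054195, 926625/4519229,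
      85525504/139564425]
  | 9 => ![625/7056, 47/10080, 1/42, 27/784, 625/5376, 6561/8960]
  | 10 => ![638391523/7933086720, 18884159/5949815040, 31726/1549431, 6325047/176290816,
      27731875/132218112, 81450625/125259264]
  | 11 => ![13/147, 361/145152, 143/9072, 55/2688, 116875/1016064, 6875/9072]
  | 12 => ![806591201/9598758960, 91489081/52793174280, 9510176/599922435, 3142557/399948290,
      22928125/112926576, 4408992/6413165]
  | 13 => ![2401/29040, 421/295680, 13/1188, 351/30976, 8125/76032, 190333/241920]
  | 14 => ![118869375/1912878352, 276450313/248674185760, 300044/51237813, 8664903/273268336,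
      14873196/85396355, 671898241/926736096]
  | 15 => ![1024/14157, 1/1152, 1/132, 63/9152, 4375/46464, 9/11]
  | 16 => ![9437873/164038875, 93134/134213625, 65792/14912625, 864/43225, 1206144/7811375,
      819200/1073709]
  | 17 => ![21627/371800, 4201/7413120, 17/3510, 357/57200, 252875/3212352, 485537/570240]
  | 18 => ![1717239817/35935972800, 3330379/7342686750, 9456/2879485, 483327/36857408,
      125428176/935832625, 31381059609/39160996000]
  | 19 => ![6250/153153, 129/320320, 19/8008, 4617/544544, 11875/192192, 45619/51480]
  | 20 => ![73489808/2163331125, 18522391/58974287625, 5125936/2336397615, 845386/86533245,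
      81961136/721110375, 2829124000/3367635183]
  | 21 => ![14641/705432, 61/192192, 0, 405/31616, 625/14144, 16875/18304]
  | 22 => ![71527079759/4245415664400, 1232770879/5244336997200, 16210172/15608145825,
      83019783/9249271600, 36838956/393094043, 148733980571/169172161200]
  | 23 => ![0, 1/4095, 0, 0, 506/12285, 11776/12285]
  | _ => 0

/-- `parameterA` as a rational number. -/
def rationalParameterA (d p : ℕ) : ℚ :=
  10 * (((p : ℚ) - 1) / ((d : ℚ) - 1)) - 1

theorem parameterA_eq_cast (d p : ℕ) : parameterA d p = (rationalParameterA d p : ℝ) := by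
  simp [parameterA, rationalParameterA]

theorem rationalParameterA_ratio (hd : d ≠ 1) :
    10 * (rationalParameterA d p + p) = (rationalParameterA d p + 1) * (d + 9) := by
  have : (d : ℚ) - 1 ≠ 0 := sub_ne_zero.2 (Nat.cast_ne_one.2 hd)
  rw [rationalParameterA]
  field_simp
  ring

theorem parameterA_eq_four (hd : d ≠ 1) (h : d + 1 = 2 * p) : parameterA d p = 4 := by
  have hd1 : (d : ℝ) - 1 ≠ 0 := sub_ne_zero.2 (Nat.cast_ne_one.2 hd)
  have hp : (d : ℝ) + 1 = 2 * p := by exact_mod_cast h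
  rw [parameterA]
  field_simp
  linarith

theorem exists_mem_parameters (hd : 3 ≤ d) (hd' : d ≤ 23) : ∃ p m, (d, p, m) ∈ parameters := by
  interval_cases d <;> simp [parameters]

theorem add_one_eq_two_mul_of_odd (h : (d, p, m) ∈ parameters) (hd : Odd d) : d + 1 = 2 * p :=
  (by decide : ∀ q ∈ parameters, Odd q.1 → q.1 + 1 = 2 * q.2.1) _ h hd

theorem bounds_of_mem_parameters (h : (d, p, m) ∈ parameters) :
    2 ≤ d ∧ p ≤ d ∧ 1 ≤ m ∧ m ≤ d + 1 ∧ 0 < rationalParameterA d p ∧ rationalParameterA d p ≠ 1 :=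
  (by decide +kernel : ∀ q ∈ parameters, 2 ≤ q.1 ∧ q.2.1 ≤ q.1 ∧ 1 ≤ q.2.2 ∧ q.2.2 ≤ q.1 + 1 ∧
    0 < rationalParameterA q.1 q.2.1 ∧ rationalParameterA q.1 q.2.1 ≠ 1) _ h

theorem ne_one_of_mem_parameters (h : (d, p, m) ∈ parameters) : d ≠ 1 := by
  have := (bounds_of_mem_parameters h).1
  omega

theorem admissibleParameters_of_mem (h : (d, p, m) ∈ parameters) :
    AdmissibleParameters d p m (parameterA d p) := by
  obtain ⟨hd, hp, hm, hmd, ha, ha1⟩ := bounds_of_mem_parameters h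
  rw [parameterA_eq_cast]
  exact ⟨hd, hp, hm, hmd, by exact_mod_cast ha, by exact_mod_cast ha1⟩

theorem orbitWeights_nonneg (d : ℕ) (j : Fin 6) : 0 ≤ orbitWeights d j := by
  unfold orbitWeights
  split <;> fin_cases j <;> norm_num

open scoped Nat in
theorem momentEquations_orbitWeights (h : (d, p, m) ∈ parameters) :
    MomentEquations d p m (rationalParameterA d p) (orbitWeights d) where
  moment := (by decide +kernel : ∀ q ∈ parameters, ∀ k < 5, ∑ j, orbitWeights q.1 j *
    generatorPowerSum q.1 q.2.1 q.2.2 (rationalParameterA q.1 q.2.1) k j =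
      (2 * k + 1)‼ / ∏ j ∈ Finset.range k, ((q.1 : ℚ) + 3 + 2 * j)) _ h
  ratio := rationalParameterA_ratio (ne_one_of_mem_parameters h)
  sixth := (by decide +kernel : ∀ q ∈ parameters, let a := rationalParameterA q.1 q.2.1
    orbitWeights q.1 5 = (a + q.2.1) ^ 5 * (60 * q.1 / (q.2.1 * a * (a - 1) ^ 2 * (a + 1) *
      (q.1 + 9) * (q.1 + 7) * (q.1 + 5) * (q.1 + 3)))) _ h

theorem momentEquations_parameterA (h : (d, p, m) ∈ parameters) :
    MomentEquations d p m (parameterA d p) (fun j ↦ (orbitWeights d j : ℝ)) := by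
  rw [parameterA_eq_cast]
  exact (momentEquations_orbitWeights h).map (Rat.castHom ℝ)

theorem isPositiveInvariantOfDegreeEleven_of_mem_parameters (h : (d, p, m) ∈ parameters) :
    (sixOrbitRule d p m (parameterA d p)
      fun j ↦ (orbitWeights d j : ℝ)).IsPositiveInvariantOfDegreeEleven := by
  refine (admissibleParameters_of_mem h).isPositiveInvariantOfDegreeEleven
    (momentEquations_parameterA h) (fun j ↦ Rat.cast_nonneg.2 (orbitWeights_nonneg d j)) ?_
  rw [parameterA_eq_cast]
  exact_mod_cast rat_sq_sub_six_mul_add_one_ne_zero _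

end Table

section Rational

theorem exists_rat_nodeV_eq_div_sqrt (n : ℕ) {r : ℕ} (hr : 1 ≤ r) :
    ∃ s : ℚ, 0 < s ∧ ∀ i, ∃ b : ℚ, nodeV n r i = (b : ℝ) / √(s : ℝ) :=
  ⟨r, by positivity, fun i ↦ ⟨if (i : ℕ) < r then 1 else 0, by
    rw [nodeV]; dsimp only; split_ifs <;> simp⟩⟩

theorem exists_rat_nodeU_eq_div_sqrt (n p : ℕ) :
    ∃ s : ℚ, 0 < s ∧ ∀ i, ∃ b : ℚ, nodeU n p 4 i = (b : ℝ) / √(s : ℝ) := by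
  have hsqrt : √(4 : ℝ) = 2 := by
    rw [show (4 : ℝ) = 2 ^ 2 by norm_num, Real.sqrt_sq zero_le_two]
  refine ⟨4 + p, by positivity,
    fun i ↦ ⟨if (i : ℕ) = 0 then 2 else if (i : ℕ) ≤ p then 1 else 0, ?_⟩⟩
  rw [nodeU]
  dsimp only
  split_ifs <;> simp [hsqrt]

theorem sixOrbitRule_four_isRational {d m : ℕ} (p : ℕ) (hm : 1 ≤ m) (q : Fin 6 → ℚ) :
    (sixOrbitRule d p m 4 fun j ↦ (q j : ℝ)).IsRational := by
  classical
  intro x hx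
  refine ⟨⟨∑ j, if x ∈ orbitB (generator d p m 4 j) then q j / orbitSize d p m j else 0, ?_⟩, ?_⟩
  · simp [sixOrbitRule, apply_ite]
  obtain ⟨j, -, hj⟩ := mem_sixOrbitRule_nodes.1 hx
  obtain ⟨σ, ε, rfl⟩ := mem_orbitB_iff.1 hj
  obtain ⟨s, hs, hb⟩ : ∃ s : ℚ, 0 < s ∧ ∀ i, ∃ b : ℚ,
      generator d p m 4 j i = (b : ℝ) / √(s : ℝ) := by
    fin_cases j
    exacts [exists_rat_nodeV_eq_div_sqrt _ d.succ_pos, exists_rat_nodeV_eq_div_sqrt _ le_rfl,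
      exists_rat_nodeV_eq_div_sqrt _ one_le_two, exists_rat_nodeV_eq_div_sqrt _ (by norm_num),
      exists_rat_nodeV_eq_div_sqrt _ hm, exists_rat_nodeU_eq_div_sqrt _ p]
  refine ⟨s, hs, fun i ↦ ?_⟩
  obtain ⟨b, hb⟩ := hb (σ i)
  exact ⟨(ε i : ℤ) * b, by rw [signedPerm_apply, hb]; push_cast; ring⟩

end Rational

section Schur

open MvPolynomial

open scoped Nat

theorem CubatureRule.sphereMean_inner_pow_two_mul {n : ℕ} [NeZero n] (k : ℕ)
    (x : EuclideanSpace ℝ (Fin n)) :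
    sphereMean (fun y ↦ inner ℝ x y ^ (2 * k)) =
      (∑ i, x i ^ 2) ^ k * ((2 * k - 1)‼ / ∏ j ∈ Finset.range k, ((n : ℝ) + 2 * j)) := by
  set w : EuclideanSpace ℝ (Fin n) := EuclideanSpace.single 0 ‖x‖ with hw
  have hreflect := Submodule.reflection_sub (by simp [hw] : ‖x‖ = ‖w‖)
  set e := Submodule.reflection (ℝ ∙ (x - w))ᗮ
  have hinner : ∀ y, inner ℝ w (e y) = inner ℝ x y := fun y ↦ by
    rw [← hreflect, LinearIsometryEquiv.inner_map_map]
  have hcoord : ∀ y : EuclideanSpace ℝ (Fin n), inner ℝ w y ^ (2 * k) =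
      (∑ i, x i ^ 2) ^ k * eval (fun i ↦ y i) (X 0 ^ (2 * k)) := fun y ↦ by
    rw [← EuclideanSpace.real_norm_sq_eq, hw, EuclideanSpace.inner_single_left, mul_pow]
    simp [pow_mul]
  calc sphereMean (fun y ↦ inner ℝ x y ^ (2 * k))
      = sphereMean (fun y ↦ inner ℝ w y ^ (2 * k)) := by
        simp only [← hinner]
        exact sphereMean_comp_linearIsometryEquiv (fun y ↦ inner ℝ w y ^ (2 * k)) e
    _ = (∑ i, x i ^ 2) ^ k * polynomialMean n (X 0 ^ (2 * k)) := by
        simp only [hcoord, sphereMean_const_mul]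
        rfl
    _ = _ := by rw [polynomialMean_X_pow_two_mul]

theorem CubatureRule.IsOfDegree.apply_inner_pow_two_mul {n t k : ℕ} [NeZero n] {Q : CubatureRule n}
    (hQ : Q.IsOfDegree t) (hk : 2 * k ≤ t) (x : EuclideanSpace ℝ (Fin n)) :
    Q.apply (fun y ↦ inner ℝ x y ^ (2 * k)) =
      (∑ i, x i ^ 2) ^ k * ((2 * k - 1)‼ / ∏ j ∈ Finset.range k, ((n : ℝ) + 2 * j)) := by
  have hform : (∑ j, C (x j) * X j : MvPolynomial (Fin n) ℝ).IsHomogeneous 1 :=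
    IsHomogeneous.sum _ _ _ fun j _ ↦ (isHomogeneous_X ℝ j).C_mul (x j)
  have hexact := hQ.1 _ ((hform.pow (2 * k)).totalDegree_le.trans (by omega))
  have heval : ∀ y : EuclideanSpace ℝ (Fin n),
      eval (fun j ↦ y j) ((∑ j, C (x j) * X j) ^ (2 * k)) = inner ℝ x y ^ (2 * k) := fun y ↦ by
    simp [PiLp.inner_apply, mul_comm]
  simp only [IsExactFor, heval] at hexact
  rw [← hexact, sphereMean_inner_pow_two_mul]

theorem sum_sign_add_mul_pow_ten (u v : ℝ) :
    ∑ ε ∈ ({1, -1} : Finset ℤ), (u + ε * v) ^ 10 =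
      2 * (u ^ 10 + 45 * u ^ 8 * v ^ 2 + 210 * u ^ 6 * v ^ 4 + 210 * u ^ 4 * v ^ 6 +
        45 * u ^ 2 * v ^ 8 + v ^ 10) := by
  rw [Finset.sum_pair (by decide)]
  push_cast
  ring

theorem schurSum_eq (x : Fin 4 → ℝ) : schurSum x = 22680 * (∑ i, x i ^ 2) ^ 5 := by
  have hIoi : Finset.Ioi (0 : Fin 4) = {1, 2, 3} ∧ Finset.Ioi (1 : Fin 4) = {2, 3} ∧
      Finset.Ioi (2 : Fin 4) = {3} ∧ Finset.Ioi (3 : Fin 4) = ∅ := by decide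
  have hsign : ∀ f : ℤ → ℝ, ∑ ε ∈ ({1, -1} : Finset ℤ), f ε = f 1 + f (-1) := fun f ↦
    Finset.sum_pair (by decide)
  have herase : ∀ (s : Finset (Fin 4)) (i : Fin 4) (f : Fin 4 → ℝ),
      ∑ j ∈ s.erase i, f j = ∑ j ∈ s, if j ≠ i then f j else 0 := fun s i f ↦ by
    rw [← Finset.sum_filter, Finset.filter_ne']
  simp only [schurSum, sum_sign_add_mul_pow_ten]
  simp only [herase, hsign, Fin.sum_univ_four, hIoi]
  simp only [Finset.mem_insert, Finset.mem_singleton, Fin.reduceEq, or_self, not_false_eq_true,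
    Finset.sum_insert, Finset.sum_singleton, Finset.sum_empty, add_zero, zero_add, ne_eq, ite_not,
    not_true_eq_false, ↓reduceIte, one_ne_zero, zero_ne_one, Int.reduceNeg, Int.cast_one,
    Int.cast_neg, one_mul, neg_mul]
  ring

end Schur

theorem isRational_of_mem_parameters {d p m : ℕ} (h : (d, p, m) ∈ parameters)
    (hdp : d + 1 = 2 * p) :
    (sixOrbitRule d p m (parameterA d p) fun j ↦ (orbitWeights d j : ℝ)).IsRational := by
  rw [parameterA_eq_four (ne_one_of_mem_parameters h) hdp]
  exact sixOrbitRule_four_isRational p (admissibleParameters_of_mem h).one_le _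

theorem isPositiveInvariantOfDegreeEleven_and_isRational_four {d p m : ℕ} (lam : Fin 6 → ℝ)
    (h : (d, p, m) ∈ parameters) (hdp : d + 1 = 2 * p)
    (hlam : ∀ j, lam j = (orbitWeights d j : ℝ)) :
    (sixOrbitRule d p m 4 lam).IsPositiveInvariantOfDegreeEleven ∧
      (sixOrbitRule d p m 4 lam).IsRational := by
  rw [funext hlam, ← parameterA_eq_four (ne_one_of_mem_parameters h) hdp]
  exact ⟨isPositiveInvariantOfDegreeEleven_of_mem_parameters h, isRational_of_mem_parameters h hdp⟩

theorem mainTheorem8 :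
    (∀ d : ℕ, 3 ≤ d → d ≤ 23 → ∃ p m : ℕ, (d, p, m) ∈ parameters) ∧
    (∀ d p m : ℕ, (d, p, m) ∈ parameters →
      0 < parameterA d p ∧ parameterA d p ≠ 1 ∧
      (Odd d → d + 1 = 2 * p) ∧
      (d + 1 = 2 * p → parameterA d p = 4) ∧
      ∃ lam : Fin 6 → ℝ,
        (∀ j, 0 ≤ lam j) ∧ ∑ j, lam j = 1 ∧
        lam 5 = (parameterA d p + p) ^ 5 *
          (60 * d / (p * parameterA d p * (parameterA d p - 1) ^ 2 * (parameterA d p + 1) *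
            (d + 9) * (d + 7) * (d + 5) * (d + 3))) ∧
        (sixOrbitRule d p m (parameterA d p) lam).IsPositiveInvariantOfDegreeEleven ∧
        (d + 1 = 2 * p → (∀ j, ∃ q : ℚ, lam j = (q : ℝ)) ∧
          (sixOrbitRule d p m (parameterA d p) lam).IsRational)) ∧
    (sixOrbitRule 3 2 4 4
      ![2 / 15, 1 / 15, 1 / 8, 0, 0, 27 / 40]).IsPositiveInvariantOfDegreeEleven ∧
    (sixOrbitRule 3 2 4 4 ![2 / 15, 1 / 15, 1 / 8, 0, 0, 27 / 40]).IsRational ∧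
    (sixOrbitRule 7 4 4 4
      ![32 / 315, 1 / 105, 2 / 45, 0, 2 / 15, 32 / 45]).IsPositiveInvariantOfDegreeEleven ∧
    (sixOrbitRule 7 4 4 4 ![32 / 315, 1 / 105, 2 / 45, 0, 2 / 15, 32 / 45]).IsRational ∧
    (sixOrbitRule 21 11 5 4
      ![14641 / 705432, 61 / 192192, 0, 405 / 31616, 625 / 14144,
        16875 / 18304]).IsPositiveInvariantOfDegreeEleven ∧
    (sixOrbitRule 21 11 5 4
      ![14641 / 705432, 61 / 192192, 0, 405 / 31616, 625 / 14144, 16875 / 18304]).IsRational ∧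
    (sixOrbitRule 23 12 4 4
      ![0, 1 / 4095, 0, 0, 506 / 12285, 11776 / 12285]).IsPositiveInvariantOfDegreeEleven ∧
    (sixOrbitRule 23 12 4 4 ![0, 1 / 4095, 0, 0, 506 / 12285, 11776 / 12285]).IsRational ∧
    (∀ x : EuclideanSpace ℝ (Fin 4),
      22680 * (∑ i, x i ^ 2) ^ 5 =
        552960 * (sixOrbitRule 3 2 4 4 ![2 / 15, 1 / 15, 1 / 8, 0, 0, 27 / 40]).apply
          (fun y => (inner ℝ x y) ^ 10) ∧
      22680 * (∑ i, x i ^ 2) ^ 5 = schurSum (fun i => x i)) := by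
  have hrule {d p m : ℕ} := @isPositiveInvariantOfDegreeEleven_and_isRational_four d p m
  obtain ⟨good₃, rational₃⟩ := hrule ![2 / 15, 1 / 15, 1 / 8, 0, 0, 27 / 40]
    (by decide : (3, 2, 4) ∈ parameters) rfl
    fun j ↦ by fin_cases j <;> norm_num [orbitWeights]
  obtain ⟨good₇, rational₇⟩ := hrule ![32 / 315, 1 / 105, 2 / 45, 0, 2 / 15, 32 / 45]
    (by decide : (7, 4, 4) ∈ parameters) rfl
    fun j ↦ by fin_cases j <;> norm_num [orbitWeights]
  obtain ⟨good₂₁, rational₂₁⟩ := hrule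
    ![14641 / 705432, 61 / 192192, 0, 405 / 31616, 625 / 14144, 16875 / 18304]
    (by decide : (21, 11, 5) ∈ parameters) rfl
    fun j ↦ by fin_cases j <;> norm_num [orbitWeights]
  obtain ⟨good₂₃, rational₂₃⟩ := hrule ![0, 1 / 4095, 0, 0, 506 / 12285, 11776 / 12285]
    (by decide : (23, 12, 4) ∈ parameters) rfl
    fun j ↦ by fin_cases j <;> norm_num [orbitWeights]
  refine ⟨fun d ↦ exists_mem_parameters, fun d p m h ↦ ?_, good₃, rational₃, good₇, rational₇,
    good₂₁, rational₂₁, good₂₃, rational₂₃, fun x ↦ ⟨?_, (schurSum_eq _).symm⟩⟩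
  · have hadm := admissibleParameters_of_mem h
    have heqs := momentEquations_parameterA h
    exact ⟨hadm.pos, hadm.ne_one, add_one_eq_two_mul_of_odd h,
      parameterA_eq_four (ne_one_of_mem_parameters h), fun j ↦ (orbitWeights d j : ℝ),
      fun j ↦ Rat.cast_nonneg.2 (orbitWeights_nonneg d j), hadm.sum_eq_one heqs, heqs.sixth,
      isPositiveInvariantOfDegreeEleven_of_mem_parameters h,
      fun hdp ↦ ⟨fun j ↦ ⟨_, rfl⟩, isRational_of_mem_parameters h hdp⟩⟩
  · rw [good₃.2.2.2.1.apply_inner_pow_two_mul (k := 5) (by norm_num)]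
    norm_num [Finset.prod_range_succ, Nat.doubleFactorial]
    ring
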